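/- For every constant $c>1$ there is a constant $C$, depending only on $c$, such that for all $0<\epsilon<1$ and $0<\delta<1$ there is a randomized adaptive group-testing algorithm $A$ with the following properties. $A$ is given the number $n$ of items; a test of a set $Q\subseteq[n]$ returns $1$ if $Q$ contains a defective item and $0$ otherwise, and the tests may depend on the earlier answers and on fair coin tosses. For fixed $c,\epsilon,\delta$, the running time of $A$ is polynomial in $n$. For every $n$ and every set $I\subseteq[n]$ of defective items, with $d=|I|$ unknown to $A$, 1. with probability at least $1-\delta$, $A$ outputs an integer $D$ with $(1-\epsilon)d\le D\le(1+\epsilon)d$; 2. the expected number of tests that $A$ makes is at most $$(1-\delta+\delta^c)\log\log d+C\sqrt{\log\log d}+C\,\frac{1}{\epsilon^2}\log\frac{1}{\delta}.$$ Here $\log$ is the logarithm to base $2$, and $\log\log d$ is read as $0$ for $d\le 2$. -/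

import Mathlib

open scoped ENNReal

namespace GroupTesting

/-- The answer of the group test `Q` when `I` is the set of defective items:
`1` if `Q` contains a defective item, and `0` otherwise. -/
def answer {n : ℕ} (I Q : Finset (Fin n)) : ℕ :=
  if (Q ∩ I).Nonempty then 1 else 0

/-- Arithmetic expressions over registers that hold natural numbers
(subtraction is truncated, division rounds down). -/
inductive Expr : Type
  | const (k : ℕ)
  | reg (x : ℕ)
  | add (a b : Expr)
  | sub (a b : Expr)
  | mul (a b : Expr)
  | div (a b : Expr)

/-- The value of an expression when register `x` holds `r x`. -/
def Expr.eval (r : ℕ → ℕ) : Expr → ℕ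
  | .const k => k
  | .reg x => r x
  | .add a b => a.eval r + b.eval r
  | .sub a b => a.eval r - b.eval r
  | .mul a b => a.eval r * b.eval r
  | .div a b => a.eval r / b.eval r

/-- The time to evaluate an expression under the logarithmic cost criterion: every number that
is read or produced is charged one step plus the length of its binary representation. -/
def Expr.cost (r : ℕ → ℕ) : Expr → ℕ
  | .const k => 1 + Nat.size k
  | .reg x => 1 + Nat.size (r x)
  | .add a b => 1 + Nat.size (a.eval r + b.eval r) + a.cost r + b.cost r
  | .sub a b => 1 + Nat.size (a.eval r - b.eval r) + a.cost r + b.cost r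
  | .mul a b => 1 + Nat.size (a.eval r * b.eval r) + a.cost r + b.cost r
  | .div a b => 1 + Nat.size (a.eval r / b.eval r) + a.cost r + b.cost r

/-- Randomized adaptive group-testing algorithms, written as programs of a random access machine
that tosses fair coins, builds up a set of items, and tests it.
* `assign x e`: store the value of `e` in register `x`;
* `coin x`: toss a fair coin and store `0` or `1` in register `x`;
* `clear`: make the current query set empty;
* `insert e`: add the item whose number is the value of `e` to the current query set
  (items are numbered from `0`; nothing is added if there is no such item);
* `ask x`: test the current query set and store the answer in register `x`;
* `seq p q`: run `p`, then `q`;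
* `ite a b p q`: run `p` if the value of `a` is at most that of `b`, and `q` otherwise;
* `loop e p`: run `p` as many times as the value that `e` has at the start. -/
inductive Prog : Type
  | assign (x : ℕ) (e : Expr)
  | coin (x : ℕ)
  | clear
  | insert (e : Expr)
  | ask (x : ℕ)
  | seq (p q : Prog)
  | ite (a b : Expr) (p q : Prog)
  | loop (e : Expr) (p : Prog)

/-- A state of the machine when there are `n` items: the registers, the current query set,
the number of tests made so far, and the number of steps made so far. -/
structure State (n : ℕ) where
  reg : ℕ → ℕ
  query : Finset (Fin n)
  asked : ℕ
  time : ℕ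

/-- `f` iterated `k` times, as a random process. -/
noncomputable def iterate {α : Type} (f : α → PMF α) : ℕ → α → PMF α
  | 0, s => PMF.pure s
  | k + 1, s => (f s).bind (iterate f k)

/-- Semantics of programs: the distribution of the final state, when the program is started in
a given state and `I` is the set of defective items. Every command charges at least one step,
so every round of a loop does. -/
noncomputable def Prog.run {n : ℕ} (I : Finset (Fin n)) : Prog → State n → PMF (State n)
  | .assign x e, s => PMF.pure { s with
      reg := Function.update s.reg x (e.eval s.reg)
      time := s.time + e.cost s.reg }
  | .coin x, s => (PMF.uniformOfFintype (Fin 2)).map fun b => { s with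
      reg := Function.update s.reg x b.val
      time := s.time + 1 }
  | .clear, s => PMF.pure { s with
      query := ∅
      time := s.time + 1 }
  | .insert e, s => PMF.pure { s with
      query := if h : e.eval s.reg < n then Insert.insert ⟨e.eval s.reg, h⟩ s.query else s.query
      time := s.time + e.cost s.reg }
  | .ask x, s => PMF.pure { s with
      reg := Function.update s.reg x (answer I s.query)
      asked := s.asked + 1
      time := s.time + 1 }
  | .seq p q, s => (p.run I s).bind (q.run I)
  | .ite a b p q, s =>
      let t : State n := { s with time := s.time + a.cost s.reg + b.cost s.reg }
      if a.eval s.reg ≤ b.eval s.reg then p.run I t else q.run I t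
  | .loop e p, s =>
      iterate (p.run I) (e.eval s.reg) { s with time := s.time + e.cost s.reg }

/-- The initial state: register `0` holds the number `n` of items, everything else is zero. -/
def initial (n : ℕ) : State n where
  reg := Function.update (fun _ => 0) 0 n
  query := ∅
  asked := 0
  time := 0

/-- The distribution of the final state of the algorithm `A` when `I` is the set of defective
items (the algorithm is given `n`, and learns about `I` only through tests). -/
noncomputable def Prog.exec (A : Prog) {n : ℕ} (I : Finset (Fin n)) : PMF (State n) :=
  A.run I (initial n)

/-- The distribution of the output, which is the final content of register `0`. -/
noncomputable def Prog.output (A : Prog) {n : ℕ} (I : Finset (Fin n)) : PMF ℕ :=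
  (A.exec I).map fun s => s.reg 0

/-- The expected number of tests (with multiplicity) that `A` makes when `I` is the set of
defective items. -/
noncomputable def Prog.expectedQueries (A : Prog) {n : ℕ} (I : Finset (Fin n)) : ℝ≥0∞ :=
  ∑' s : State n, A.exec I s * (s.asked : ℝ≥0∞)

/-- The running time of `A` is polynomial in the number of items, for every set of defective
items and every outcome of the coin tosses. -/
def Prog.PolynomialTime (A : Prog) : Prop :=
  ∃ P : Polynomial ℕ, ∀ (n : ℕ) (I : Finset (Fin n)), ∀ s ∈ (A.exec I).support,
    s.time ≤ P.eval n

/-- `log log d` to base `2`, read as `0` for `d ≤ 2`. -/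
noncomputable def loglog (d : ℕ) : ℝ :=
  Real.logb 2 (Real.logb 2 (max d 2 : ℕ))

end GroupTesting

namespace GroupTesting

/-! For d ≥ 1, a test of a random set that contains each item with probability 2⁻ᵏ is negative with
probability (1 - 2⁻ᵏ)ᵈ. This probability increases with k and passes from small to large near a
threshold κ, roughly log d. The answer therefore suggests on which side of κ the parameter k lies,
and the chance of a misleading answer decays geometrically with |k - κ|. Hence the sum over all k of
(error probability) × |k - κ| is bounded by an absolute constant (`IsThreshold.sum_errCost_le`), and
κ can be searched for without repeating any test: a wrong answer at k displaces the result by about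
|k - κ|, so the expected final displacement is O(1) (`expLE_search`).

The search gallops through k = 2^(t²) and then bisects in t² tests. It overshoots at about t =
√(loglog d): the gallop costs only O(√(loglog d)) tests, and since (t + 1)² - t² = 2t + 1, the
rounding of t costs only O(√(loglog d)) more bisection tests. The leading term is thus loglog d with
coefficient 1 (`exists_searchCost_le`).

A walk then repairs the displacement. Each of its steps repeats the test m times, with m of order
ε⁻² log(1/δ'), where δ' is the allowed failure probability. An accurate measurement either moves
towards κ or stops, so the expected number of steps is O(1) (`expLE_walk_asked`), and the failure
probability is exponentially small in m times the expected displacement plus one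
(`expLE_walk_fail`). Where the walk stops, the fraction of negative answers is bounded away from 0
and 1, and inverting (1 - 2⁻ᵏ)ᵈ gives d up to a factor 1 ± ε (`estimate_of_goodStop`).

To replace the coefficient 1 by 1 - δ + δᶜ, this procedure, with δ' = δᶜ / 3, is run only with a
dyadic probability slightly above 1 - δ; otherwise 0 is output without a test (`expLE_biased`).

Expectations are bounded by potential functions that do not increase in expectation (`ExpLE`). The
running time is bounded separately, in the worst case, by tracking the size of the registers
(`Takes`). -/

/-- Every outcome of `μ` satisfies `Q`, and the expectation of `F` (with negative values read
as `0`) is at most `v`. -/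
def ExpLE {α : Type} (μ : PMF α) (Q : α → Prop) (F : α → ℝ) (v : ℝ) : Prop :=
  (∀ a ∈ μ.support, Q a) ∧ ∑' a, μ a * ENNReal.ofReal (F a) ≤ ENNReal.ofReal v

/-! ### Potential functions for random processes -/

section ExpLE

variable {α β : Type} {μ : PMF α} {Q Q' : α → Prop} {F F' : α → ℝ} {v v' : ℝ}

theorem ExpLE.mono (h : ExpLE μ Q F v) (hQ : ∀ a, Q a → Q' a) (hF : ∀ a, Q a → F' a ≤ F a)
    (hv : v ≤ v') : ExpLE μ Q' F' v' := by
  refine ⟨fun a ha => hQ a (h.1 a ha), le_trans (ENNReal.tsum_le_tsum fun a => ?_)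
    (h.2.trans (ENNReal.ofReal_le_ofReal hv))⟩
  by_cases ha : a ∈ μ.support
  · exact mul_le_mul_right (ENNReal.ofReal_le_ofReal (hF a (h.1 a ha))) _
  · rw [PMF.mem_support_iff, not_not] at ha
    simp [ha]

theorem ExpLE.of_support (h : ∀ a ∈ μ.support, Q a ∧ F a ≤ v) : ExpLE μ Q F v := by
  refine ⟨fun a ha => (h a ha).1, le_trans (ENNReal.tsum_le_tsum (g := fun a =>
    μ a * ENNReal.ofReal v) fun a => ?_) ?_⟩
  · by_cases ha : a ∈ μ.support
    · exact mul_le_mul_right (ENNReal.ofReal_le_ofReal (h a ha).2) _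
    · rw [PMF.mem_support_iff, not_not] at ha
      simp [ha]
  · rw [ENNReal.tsum_mul_right, PMF.tsum_coe, one_mul]

theorem ExpLE.pure {a : α} (hQ : Q a) (hF : F a ≤ v) : ExpLE (PMF.pure a) Q F v :=
  ExpLE.of_support fun b hb => by
    rw [PMF.support_pure, Set.mem_singleton_iff] at hb
    subst hb
    exact ⟨hQ, hF⟩

/-- The tower property: the intermediate potential `F` must dominate the conditional expectation of
`G` at every reachable `a`. -/
theorem ExpLE.bind {ν : α → PMF β} {R : β → Prop} {G : β → ℝ} (h : ExpLE μ Q F v)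
    (hν : ∀ a, Q a → ExpLE (ν a) R G (F a)) : ExpLE (μ.bind ν) R G v := by
  constructor
  · intro b hb
    obtain ⟨a, ha, hab⟩ := (PMF.mem_support_bind_iff _ _ _).1 hb
    exact (hν a (h.1 a ha)).1 b hab
  · refine le_trans ?_ h.2
    simp only [PMF.bind_apply, ← ENNReal.tsum_mul_right]
    rw [ENNReal.tsum_comm]
    refine ENNReal.tsum_le_tsum fun a => ?_
    simp only [mul_assoc, ENNReal.tsum_mul_left]
    by_cases ha : a ∈ μ.support
    · exact mul_le_mul_right (hν a (h.1 a ha)).2 _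
    · rw [PMF.mem_support_iff, not_not] at ha
      simp [ha]

theorem ExpLE.add_const {c : ℝ} (h : ExpLE μ Q F v) (hv : 0 ≤ v) (hc : 0 ≤ c) :
    ExpLE μ Q (fun a => F a + c) (v + c) := by
  refine ⟨h.1, ?_⟩
  rw [ENNReal.ofReal_add hv hc]
  refine le_trans (ENNReal.tsum_le_tsum (g := fun a =>
    μ a * ENNReal.ofReal (F a) + μ a * ENNReal.ofReal c) fun a => ?_) ?_
  · rw [← mul_add]
    exact mul_le_mul_right ENNReal.ofReal_add_le _
  · rw [ENNReal.tsum_add, ENNReal.tsum_mul_right (a := ENNReal.ofReal c), PMF.tsum_coe, one_mul]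
    exact add_le_add_left h.2 _

/-- Nonnegativity of both values is needed since `ENNReal.ofReal` truncates and is additive only on
nonnegative reals. -/
theorem ExpLE.coin {g : Fin 2 → α} (h0 : Q (g 0)) (h1 : Q (g 1)) (f0 : 0 ≤ F (g 0))
    (f1 : 0 ≤ F (g 1)) (hv : (F (g 0) + F (g 1)) / 2 ≤ v) :
    ExpLE ((PMF.uniformOfFintype (Fin 2)).map g) Q F v := by
  rw [← PMF.bind_pure_comp]
  refine ExpLE.bind (Q := fun _ => True) (F := fun b => F (g b)) ⟨fun _ _ => trivial, ?_⟩ ?_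
  · rw [tsum_fintype, Fin.sum_univ_two]
    simp only [PMF.uniformOfFintype_apply, Fintype.card_fin]
    rw [← mul_add, ← ENNReal.ofReal_add f0 f1]
    refine le_trans (le_of_eq ?_) (ENNReal.ofReal_le_ofReal hv)
    rw [div_eq_inv_mul, ENNReal.ofReal_mul (by norm_num), ENNReal.ofReal_inv_of_pos (by norm_num)]
    simp
  · intro b _
    refine ExpLE.pure ?_ le_rfl
    fin_cases b
    · exact h0
    · exact h1

/-- The loop rule: `Q` is an invariant and `F` a supermartingale, both indexed by the round. -/
theorem ExpLE.iterate {f : α → PMF α} (N : ℕ) {Q : ℕ → α → Prop} {F : ℕ → α → ℝ}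
    (h : ∀ i < N, ∀ a, Q i a → ExpLE (f a) (Q (i + 1)) (F (i + 1)) (F i a)) (a : α)
    (ha : Q 0 a) : ExpLE (iterate f N a) (Q N) (F N) (F 0 a) := by
  induction N generalizing Q F a with
  | zero => exact ExpLE.pure ha le_rfl
  | succ N ih =>
    refine ExpLE.bind (h 0 (Nat.succ_pos N) a ha) fun b hb => ?_
    exact ih (Q := fun i => Q (i + 1)) (F := fun i => F (i + 1))
      (fun i hi => h (i + 1) (Nat.succ_lt_succ hi)) b hb

end ExpLE

/-! ### Rules for programs -/

section Rules

variable {n : ℕ} {I : Finset (Fin n)} {s : State n} {Q R : State n → Prop} {F G : State n → ℝ}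
  {v : ℝ} {p q : Prog}

theorem ExpLE.seq (h : ExpLE (p.run I s) Q F v)
    (h' : ∀ t, Q t → ExpLE (q.run I t) R G (F t)) : ExpLE ((Prog.seq p q).run I s) R G v := by
  rw [Prog.run]
  exact h.bind h'

theorem ExpLE.seq_of_det {t : State n} (h : p.run I s = PMF.pure t)
    (h' : ExpLE (q.run I t) R G v) : ExpLE ((Prog.seq p q).run I s) R G v := by
  rw [Prog.run, h, PMF.pure_bind]
  exact h'

/-- Here and below the clock `τ` is universally quantified, so that the bounds on tests and errors
never follow the running time. -/
theorem ExpLE.assign {x : ℕ} {e : Expr}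
    (h : ∀ τ, R ⟨Function.update s.reg x (e.eval s.reg), s.query, s.asked, τ⟩ ∧
      G ⟨Function.update s.reg x (e.eval s.reg), s.query, s.asked, τ⟩ ≤ v) :
    ExpLE ((Prog.assign x e).run I s) R G v := by
  rw [Prog.run]
  exact ExpLE.pure (h _).1 (h _).2

theorem ExpLE.assign_seq {x : ℕ} {e : Expr}
    (h : ∀ τ, ExpLE (q.run I ⟨Function.update s.reg x (e.eval s.reg), s.query, s.asked, τ⟩) R G v) :
    ExpLE ((Prog.seq (.assign x e) q).run I s) R G v :=
  ExpLE.seq_of_det (by rw [Prog.run]) (h _)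

theorem ExpLE.ite {a b : Expr}
    (h : ∀ τ, a.eval s.reg ≤ b.eval s.reg →
      ExpLE (p.run I ⟨s.reg, s.query, s.asked, τ⟩) R G v)
    (h' : ∀ τ, ¬ a.eval s.reg ≤ b.eval s.reg →
      ExpLE (q.run I ⟨s.reg, s.query, s.asked, τ⟩) R G v) :
    ExpLE ((Prog.ite a b p q).run I s) R G v := by
  rw [Prog.run]
  split_ifs with hab
  · exact h _ hab
  · exact h' _ hab

theorem ExpLE.loop {e : Expr} (N : ℕ) (hN : e.eval s.reg = N) (J : ℕ → State n → Prop)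
    (K : ℕ → State n → ℝ) (h0 : ∀ τ, J 0 ⟨s.reg, s.query, s.asked, τ⟩)
    (hv : ∀ τ, K 0 ⟨s.reg, s.query, s.asked, τ⟩ ≤ v)
    (h : ∀ i < N, ∀ t, J i t → ExpLE (p.run I t) (J (i + 1)) (K (i + 1)) (K i t))
    (hR : ∀ t, J N t → R t) (hG : ∀ t, J N t → G t ≤ K N t) :
    ExpLE ((Prog.loop e p).run I s) R G v := by
  rw [Prog.run, hN]
  exact (ExpLE.iterate N h _ (h0 _)).mono hR hG (hv _)

end Rules

/-! ### A single random test -/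

/-- Registers `0` and `5, 6, …` agree; the others are scratch registers of `randomTest`. -/
def Frame (r r' : ℕ → ℕ) : Prop := ∀ x, x = 0 ∨ 5 ≤ x → r' x = r x

theorem Frame.refl (r : ℕ → ℕ) : Frame r r := fun _ _ => rfl

theorem Frame.trans {r r' r'' : ℕ → ℕ} (h : Frame r r') (h' : Frame r' r'') : Frame r r'' :=
  fun x hx => (h' x hx).trans (h x hx)

theorem Frame.update {r r' : ℕ → ℕ} (h : Frame r r') {x : ℕ} (hx : 1 ≤ x ∧ x ≤ 4) (v : ℕ) :
    Frame r (Function.update r' x v) := fun y hy => by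
  rw [Function.update_of_ne (by omega), h y hy]

/-- Toss as many coins as register `10` says, and count the ones in register `3`. -/
def tossCoins : Prog :=
  .seq (.assign 3 (.const 0))
    (.loop (.reg 10) (.seq (.coin 4) (.assign 3 (.add (.reg 3) (.reg 4)))))

/-- Insert the item in register `2` with probability `2⁻ᵏ`, with `k` in register `10`, and
go to the next item. -/
def sampleItem : Prog :=
  .seq tossCoins (.seq (.ite (.reg 3) (.const 0) (.insert (.reg 2)) (.assign 4 (.const 0)))
    (.assign 2 (.add (.reg 2) (.const 1))))

/-- Test a random set that contains every item with probability `2⁻ᵏ`, with `k` in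
register `10`; the answer goes to register `1`. -/
def randomTest : Prog :=
  .seq .clear (.seq (.assign 2 (.const 0)) (.seq (.loop (.reg 0) sampleItem) (.ask 1)))

/-- The probability that a random set which contains every item with probability `2⁻ᵏ` avoids
`d` given items. -/
noncomputable def missProb (d k : ℕ) : ℝ := (1 - (1 / 2 : ℝ) ^ k) ^ d

theorem half_pow_nonneg (k : ℕ) : (0 : ℝ) ≤ (1 / 2) ^ k := by positivity

theorem half_pow_le_one (k : ℕ) : (1 / 2 : ℝ) ^ k ≤ 1 := pow_le_one₀ (by norm_num) (by norm_num)

theorem missProb_nonneg (d k : ℕ) : 0 ≤ missProb d k :=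
  pow_nonneg (by linarith [half_pow_le_one k]) _

theorem missProb_le_one (d k : ℕ) : missProb d k ≤ 1 :=
  pow_le_one₀ (by linarith [half_pow_le_one k]) (by linarith [half_pow_nonneg k])

variable {n : ℕ} {I : Finset (Fin n)}

/-- The potential is `B` once a one has been seen, and otherwise the mixture for the coins still to
be tossed. Arbitrary `A` and `B` let the values of any continuation be inserted for the two
outcomes. -/
theorem expLE_tossCoins (s : State n) {A B : ℝ} (hA : 0 ≤ A) (hB : 0 ≤ B) :
    ExpLE (tossCoins.run I s)
      (fun s' => Frame s.reg s'.reg ∧ s'.query = s.query ∧ s'.asked = s.asked ∧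
        s'.reg 2 = s.reg 2)
      (fun s' => if s'.reg 3 = 0 then A else B)
      ((1 / 2) ^ s.reg 10 * A + (1 - (1 / 2) ^ s.reg 10) * B) := by
  set k := s.reg 10 with hk
  refine ExpLE.assign_seq fun τ => ExpLE.loop k ?_
    (fun _ (s' : State n) => Frame s.reg s'.reg ∧ s'.query = s.query ∧
      s'.asked = s.asked ∧ s'.reg 2 = s.reg 2)
    (fun i s' => if s'.reg 3 = 0 then (1 / 2) ^ (k - i) * A + (1 - (1 / 2) ^ (k - i)) * B
      else B) (fun τ => ?_) (fun τ => ?_) (fun i hi t ht => ?_) (fun _ h => h) (fun t _ => ?_)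
  · simp [Expr.eval, hk]
  · exact ⟨(Frame.refl _).update (by norm_num) _, rfl, rfl, by simp⟩
  · simp [Expr.eval]
  · have h1 := half_pow_nonneg (k - (i + 1))
    have h2 := half_pow_le_one (k - (i + 1))
    have h3 : 0 ≤ (1 / 2 : ℝ) ^ (k - (i + 1)) * A + (1 - (1 / 2) ^ (k - (i + 1))) * B :=
      add_nonneg (mul_nonneg h1 hA) (mul_nonneg (by linarith) hB)
    have h4 : (1 / 2 : ℝ) ^ (k - i) = 1 / 2 * (1 / 2) ^ (k - (i + 1)) := by
      rw [← pow_succ']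
      congr 1
      omega
    refine ExpLE.seq (Q := fun t' => Frame s.reg t'.reg ∧ t'.query = s.query ∧
      t'.asked = s.asked ∧ t'.reg 2 = s.reg 2)
      (F := fun t' => if t'.reg 3 + t'.reg 4 = 0 then
        (1 / 2) ^ (k - (i + 1)) * A + (1 - (1 / 2) ^ (k - (i + 1))) * B
      else B) ?_ fun t' ht' => ExpLE.assign fun τ => ⟨?_, ?_⟩
    · rw [Prog.run]
      refine ExpLE.coin ?_ ?_ ?_ ?_ ?_
      · exact ⟨ht.1.update (by norm_num) _, ht.2.1, ht.2.2.1, by simpa using ht.2.2.2⟩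
      · exact ⟨ht.1.update (by norm_num) _, ht.2.1, ht.2.2.1, by simpa using ht.2.2.2⟩
      · dsimp only
        split_ifs <;> assumption
      · dsimp only
        split_ifs <;> assumption
      · simp only [Function.update_self, Fin.val_zero, Fin.val_one, add_zero]
        rw [Function.update_of_ne (by norm_num), Function.update_of_ne (by norm_num),
          if_neg (by omega : ¬ (t.reg 3 + 1 = 0))]
        split_ifs
        · rw [h4]
          linarith
        · linarith
    · exact ⟨ht'.1.update (by norm_num) _, ht'.2.1, ht'.2.2.1, by simpa using ht'.2.2.2⟩
    · simp [Expr.eval]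
  · simp

theorem expLE_randomTest (s : State n) (hn : s.reg 0 = n) {A B : ℝ} (hA : 0 ≤ A) (hB : 0 ≤ B) :
    ExpLE (randomTest.run I s)
      (fun s' => Frame s.reg s'.reg ∧ s'.asked = s.asked + 1 ∧
        (s'.reg 1 = 0 ∨ s'.reg 1 = 1 ∧ I.Nonempty))
      (fun s' => if s'.reg 1 = 0 then A else B)
      (missProb I.card (s.reg 10) * A + (1 - missProb I.card (s.reg 10)) * B) := by
  set k := s.reg 10 with hk
  -- `rest i` is the probability that none of the items `i, i + 1, …` puts a defective item into the
  -- query set. The potential is `B` if the set already meets `I`, and otherwise the mixture with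
  -- weight `rest i`.
  set rest : ℕ → ℝ := fun i => missProb (I.filter fun x => i ≤ x.val).card k with hrest
  have r0 : ∀ i, 0 ≤ rest i := fun i => missProb_nonneg _ _
  have r1 : ∀ i, rest i ≤ 1 := fun i => missProb_le_one _ _
  have mix : ∀ i, 0 ≤ rest i * A + (1 - rest i) * B := fun i =>
    add_nonneg (mul_nonneg (r0 i) hA) (mul_nonneg (by linarith [r1 i]) hB)
  refine ExpLE.seq_of_det (by rw [Prog.run]) (ExpLE.assign_seq fun τ => ExpLE.seq
    (Q := fun s' => Frame s.reg s'.reg ∧ s'.asked = s.asked)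
    (F := fun s' => if (s'.query ∩ I).Nonempty then B else A) (ExpLE.loop n ?_
    (fun i s' => Frame s.reg s'.reg ∧ s'.asked = s.asked ∧ s'.reg 2 = i)
    (fun i s' => if (s'.query ∩ I).Nonempty then B else rest i * A + (1 - rest i) * B)
    (fun τ => ?_) (fun τ => ?_) (fun i hi t ht => ?_) (fun _ h => ⟨h.1, h.2.1⟩)
    (fun t _ => ?_)) fun t ht => ?_)
  · simp [Expr.eval, hn]
  · exact ⟨(Frame.refl _).update (by norm_num) _, rfl, by simp [Expr.eval]⟩
  · simp [hrest]
  · obtain ⟨h1, h2, h3⟩ := ht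
    have hk' : t.reg 10 = k := by rw [h1 10 (by norm_num), hk]
    set x : Fin n := ⟨i, hi⟩
    set P : Finset (Fin n) → ℝ := fun q => if (q ∩ I).Nonempty then B
      else rest (i + 1) * A + (1 - rest (i + 1)) * B with hP
    have P0 : ∀ q, 0 ≤ P q := fun q => by
      simp only [hP]
      split_ifs
      exacts [hB, mix _]
    refine ExpLE.mono (ExpLE.seq (expLE_tossCoins t (P0 (insert x t.query)) (P0 t.query))
      fun t' ⟨g1, g2, g3, g4⟩ => ExpLE.seq
        (Q := fun t' => Frame t.reg t'.reg ∧ t'.asked = s.asked ∧ t'.reg 2 = i)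
        (F := fun t' => P t'.query) (ExpLE.ite (fun τ h => ?_) (fun τ h => ?_))
        fun t'' g => ExpLE.assign fun τ => ⟨⟨?_, g.2.1, ?_⟩, le_rfl⟩)
        (fun _ h => h) (fun _ _ => le_rfl) ?_
    · simp only [Expr.eval, nonpos_iff_eq_zero] at h
      rw [Prog.run, if_pos h]
      refine ExpLE.pure ⟨g1, by rw [g3, h2], by rw [g4, h3]⟩ ?_
      simp only [Expr.eval, g4, h3, hi, g2, dif_pos]
      exact le_rfl
    · simp only [Expr.eval, nonpos_iff_eq_zero] at h
      rw [if_neg h]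
      refine ExpLE.assign fun τ => ⟨⟨g1.update (by norm_num) _, by rw [g3, h2], ?_⟩, ?_⟩
      · rw [← h3, ← g4]
        simp
      · rw [g2]
    · rw [hk']
      simp only [hP]
      -- Only a defective `x`, with a query set that still misses `I`, changes the chances; it
      -- contributes one factor `1 - 2⁻ᵏ`.
      by_cases hq : (t.query ∩ I).Nonempty
      · have : (insert x t.query ∩ I).Nonempty :=
          hq.mono (Finset.inter_subset_inter_right (Finset.subset_insert _ _))
        rw [if_pos hq, if_pos hq, if_pos this]
        linarith
      · rw [if_neg hq, if_neg hq]
        by_cases hx : x ∈ I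
        · have : (insert x t.query ∩ I).Nonempty := ⟨x, by simp [hx]⟩
          rw [if_pos this]
          have hc : rest i = (1 - (1 / 2) ^ k) * rest (i + 1) := by
            simp only [hrest, missProb]
            rw [← pow_succ']
            congr 1
            rw [show (I.filter fun y => i ≤ y.val) = insert x (I.filter fun y => i + 1 ≤ y.val) by
              ext y
              simp only [Finset.mem_filter, Finset.mem_insert, Fin.ext_iff]
              constructor
              · rintro ⟨ha, hb⟩
                rcases hb.eq_or_lt with hb | hb
                · exact Or.inl hb.symm
                · exact Or.inr ⟨ha, hb⟩
              · rintro (ha | ⟨ha, hb⟩)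
                · exact ⟨by rwa [show y = x from Fin.ext ha], ha.ge⟩
                · exact ⟨ha, by omega⟩, Finset.card_insert_of_notMem (by simp [x])]
          rw [hc]
          linarith
        · have : ¬ (insert x t.query ∩ I).Nonempty := by
            rwa [Finset.insert_inter_of_notMem hx]
          rw [if_neg this]
          have hc : rest i = rest (i + 1) := by
            simp only [hrest]
            congr 2
            ext y
            simp only [Finset.mem_filter, and_congr_right_iff]
            intro hy
            have : y.val ≠ i := fun h => hx (by rwa [show x = y from Fin.ext h.symm])
            omega
          rw [hc]
          linarith
    · exact (h1.trans g.1).update (by norm_num) _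
    · simp [Expr.eval, g.2.2]
  · have hr : rest n = 1 := by
      simp only [hrest, missProb]
      rw [Finset.filter_false_of_mem (fun x _ => by omega)]
      simp
    simp [hr]
  · rw [Prog.run]
    refine ExpLE.pure ⟨ht.1.update (by norm_num) _, by simp [ht.2], ?_⟩ ?_
    · simp only [Function.update_self, answer]
      split_ifs with h
      · exact Or.inr ⟨rfl, h.mono Finset.inter_subset_right⟩
      · exact Or.inl rfl
    · simp only [Function.update_self, answer]
      split_ifs <;> simp_all

end GroupTesting

/-! ### Concentration of repeated tests -/

namespace GroupTesting

variable {n : ℕ} {I : Finset (Fin n)}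

/-- From `exp y ≤ 1 + y + y²` for `|y| ≤ 1`: the linear terms cancel, the quadratic ones sum to `z
(1 - z) l² ≤ l²`, and `1 + l² ≤ exp (l²)`. -/
theorem bernoulli_mgf_le {z l : ℝ} (h0 : 0 ≤ z) (h1 : z ≤ 1) (hl : |l| ≤ 1) :
    z * Real.exp (l * (1 - z)) + (1 - z) * Real.exp (-(l * z)) ≤ Real.exp (l ^ 2) := by
  have a1 : |l * (1 - z)| ≤ 1 := by
    rw [abs_mul, abs_of_nonneg (by linarith : 0 ≤ 1 - z)]
    nlinarith [abs_nonneg l]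
  have a2 : |-(l * z)| ≤ 1 := by
    rw [abs_neg, abs_mul, abs_of_nonneg h0]
    nlinarith [abs_nonneg l]
  have b1 := (abs_le.1 (Real.abs_exp_sub_one_sub_id_le a1)).2
  have b2 := (abs_le.1 (Real.abs_exp_sub_one_sub_id_le a2)).2
  have b3 := Real.add_one_le_exp (l ^ 2)
  have c1 := mul_le_mul_of_nonneg_left b1 h0
  have c2 := mul_le_mul_of_nonneg_left b2 (by linarith : 0 ≤ 1 - z)
  have c3 : z * (1 - z) * l ^ 2 ≤ 1 * l ^ 2 :=
    mul_le_mul_of_nonneg_right (by nlinarith) (sq_nonneg l)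
  nlinarith

/-- Make `m` random tests with the parameter in register `10`, and count the negative answers in
register `11`. -/
def measure (m : ℕ) : Prog :=
  .seq (.assign 11 (.const 0))
    (.loop (.const m) (.seq randomTest (.assign 11 (.add (.reg 11) (.sub (.const 1) (.reg 1))))))

/-- Registers `0`, `5, …, 10` and `12, 13, …` agree; the others are used by `measure`. -/
def FrameMeasure (r r' : ℕ → ℕ) : Prop := ∀ x, x = 0 ∨ 5 ≤ x ∧ x ≠ 11 → r' x = r x

/-- Chernoff's bound in potential form: the sum of the two exponential supermartingales with slopes
`l` and `-l` is at least `1` whenever the final deviation exceeds `α m`. -/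
theorem expLE_measure (m : ℕ) (s : State n) (hn : s.reg 0 = n) {A B α : ℝ} (hA : 0 ≤ A)
    (hB : 0 ≤ B) (hα : 0 < α) (hα1 : α ≤ 1) :
    ExpLE ((measure m).run I s)
      (fun s' => FrameMeasure s.reg s'.reg ∧ s'.asked = s.asked + m)
      (fun s' => if |(s'.reg 11 : ℝ) - m * missProb I.card (s.reg 10)| ≤ α * m then A else A + B)
      (A + B * (2 * Real.exp (-(m * α ^ 2 / 4)))) := by
  set k := s.reg 10 with hk
  set z := missProb I.card k with hz
  have z0 : 0 ≤ z := missProb_nonneg _ _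
  have z1 : z ≤ 1 := missProb_le_one _ _
  -- This value minimizes the initial exponent `-(l α m) + m l²`, which becomes `-m α² / 4`.
  set l : ℝ := α / 2 with hl
  have hl0 : 0 ≤ l := by positivity
  set Φ : ℕ → ℝ → ℝ := fun i Z => A + B * (Real.exp (-(l * α * m) + (m - i) * l ^ 2 + l * (Z - i * z))
    + Real.exp (-(l * α * m) + (m - i) * l ^ 2 + -l * (Z - i * z))) with hΦ
  have Φ0 : ∀ i Z, 0 ≤ Φ i Z := fun i Z => by positivity
  have step : ∀ (i : ℕ) (Z : ℝ), z * Φ (i + 1) (Z + 1) + (1 - z) * Φ (i + 1) Z ≤ Φ i Z := by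
    intro i Z
    have aux : ∀ c : ℝ, |c| ≤ 1 → c ^ 2 = l ^ 2 →
        z * Real.exp (-(l * α * m) + (m - (i + 1 : ℕ)) * l ^ 2 + c * (Z + 1 - (i + 1 : ℕ) * z)) +
        (1 - z) * Real.exp (-(l * α * m) + (m - (i + 1 : ℕ)) * l ^ 2 + c * (Z - (i + 1 : ℕ) * z)) ≤
        Real.exp (-(l * α * m) + (m - i) * l ^ 2 + c * (Z - i * z)) := by
      intro c hc hc2
      have h := mul_le_mul_of_nonneg_left (bernoulli_mgf_le z0 z1 hc)
        (Real.exp_pos (-(l * α * m) + (m - (i + 1 : ℕ)) * l ^ 2 + c * (Z - i * z))).le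
      rw [mul_add, ← Real.exp_add, mul_left_comm, mul_left_comm _ (1 - z), ← Real.exp_add,
        ← Real.exp_add, hc2] at h
      refine le_trans (le_of_eq ?_) (h.trans (le_of_eq ?_))
      · push_cast
        congr 3 <;> ring
      · push_cast
        congr 1
        ring
    have hb : |l| ≤ 1 := by
      rw [abs_of_nonneg hl0]
      linarith
    have e1 := mul_le_mul_of_nonneg_left (aux l hb rfl) hB
    have e2 := mul_le_mul_of_nonneg_left (aux (-l) (by rwa [abs_neg]) (by ring)) hB
    simp only [hΦ]
    linarith
  refine ExpLE.assign_seq fun τ => ExpLE.loop m rfl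
    (fun i (s' : State n) => FrameMeasure s.reg s'.reg ∧ s'.asked = s.asked + i)
    (fun i s' => Φ i (s'.reg 11)) (fun τ => ⟨fun x hx => ?_, rfl⟩) (fun τ => ?_)
    (fun i hi t ht => ?_) (fun _ h => h) (fun t _ => ?_)
  · dsimp only
    rw [Function.update_of_ne (by omega)]
  · simp only [Expr.eval, Function.update_self, hΦ, Nat.cast_zero]
    rw [show -(l * α * m) + (m - 0) * l ^ 2 + l * (0 - 0 * z) = -(m * α ^ 2 / 4) by rw [hl]; ring,
      show -(l * α * m) + (m - 0) * l ^ 2 + -l * (0 - 0 * z) = -(m * α ^ 2 / 4) by rw [hl]; ring]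
    linarith
  · have h := expLE_randomTest (I := I) t (by rw [ht.1 0 (by norm_num), hn])
      (Φ0 (i + 1) (t.reg 11 + 1)) (Φ0 (i + 1) (t.reg 11))
    rw [ht.1 10 (by norm_num), ← hk, ← hz] at h
    refine ExpLE.mono (ExpLE.seq h fun t' ht' => ExpLE.assign fun τ => ?_)
      (fun _ h => h) (fun _ _ => le_rfl) (step i _)
    refine ⟨⟨?_, ?_⟩, ?_⟩
    · intro x hx
      dsimp only
      rw [Function.update_of_ne (by omega), ht'.1 x (by omega), ht.1 x hx]
    · rw [ht'.2.1, ht.2, add_assoc]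
    · simp only [Expr.eval, Function.update_self, ht'.1 11 (by norm_num)]
      rcases ht'.2.2 with h | ⟨h, -⟩ <;> simp [h]
  · simp only [hΦ, sub_self, zero_mul, add_zero]
    set y := (t.reg 11 : ℝ) - m * z
    have p1 := Real.exp_pos (-(l * α * m) + l * y)
    have p2 := Real.exp_pos (-(l * α * m) + -l * y)
    split_ifs with h
    · have := mul_nonneg hB (add_pos p1 p2).le
      linarith
    · rw [not_le, lt_abs] at h
      have : 1 ≤ Real.exp (-(l * α * m) + l * y) + Real.exp (-(l * α * m) + -l * y) := by
        rcases h with h | h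
        · have := Real.one_le_exp (show 0 ≤ -(l * α * m) + l * y by nlinarith)
          linarith
        · have := Real.one_le_exp (show 0 ≤ -(l * α * m) + -l * y by nlinarith)
          linarith
      nlinarith

/-! ### The probability of a negative answer -/

/-- This is `1 - x ≤ (1 - x / 2)²`, raised to the power `d`. It makes the probability of a
misleading answer decay away from the threshold. -/
theorem missProb_succ_sq (d k : ℕ) : missProb d k ≤ missProb d (k + 1) ^ 2 := by
  rw [missProb, missProb, ← pow_mul, mul_comm, pow_mul, pow_succ (1 / 2 : ℝ)]
  have h0 := half_pow_nonneg k
  have h1 := half_pow_le_one k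
  exact pow_le_pow_left₀ (by linarith) (by nlinarith) _

theorem missProb_mono (d : ℕ) : Monotone (missProb d) :=
  monotone_nat_of_le_succ fun k => (missProb_succ_sq d k).trans
    (by nlinarith [missProb_nonneg d (k + 1), missProb_le_one d (k + 1)])

/-- The opposite inequality, with a cube, holds once `x = 2⁻ᵏ ≤ 1 / 2`. It prevents the probability
from jumping past `2 / 3` in the step where it reaches `1 / 4`. -/
theorem missProb_succ_cube (d : ℕ) {k : ℕ} (hk : 1 ≤ k) : missProb d (k + 1) ^ 3 ≤ missProb d k := by
  rw [missProb, missProb, ← pow_mul, mul_comm, pow_mul, pow_succ (1 / 2 : ℝ)]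
  have h0 := half_pow_nonneg k
  have h1 : (1 / 2 : ℝ) ^ k ≤ 1 / 2 := by
    simpa using pow_le_pow_of_le_one (by norm_num : (0 : ℝ) ≤ 1 / 2) (by norm_num) hk
  refine pow_le_pow_left₀ (pow_nonneg (by linarith) _) ?_ _
  generalize (1 / 2 : ℝ) ^ k = x at *
  have e : 1 - x - (1 - x * (1 / 2)) ^ 3 = x * (1 / 2 - 3 / 4 * x + x ^ 2 / 8) := by ring
  have : 0 ≤ x * (1 / 2 - 3 / 4 * x + x ^ 2 / 8) := mul_nonneg h0 (by nlinarith [sq_nonneg x])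
  linarith

theorem missProb_zero {d : ℕ} (hd : 1 ≤ d) : missProb d 0 = 0 := by
  simp [missProb, show d ≠ 0 by omega]

theorem missProb_one {d : ℕ} (hd : 1 ≤ d) : missProb d 1 ≤ 1 / 2 := by
  rw [missProb]
  norm_num
  simpa using pow_le_pow_of_le_one (by norm_num : (0 : ℝ) ≤ 1 / 2) (by norm_num) hd

theorem one_sub_missProb_le (d k : ℕ) : 1 - missProb d k ≤ d * (1 / 2) ^ k := by
  have := one_add_mul_le_pow (a := -(1 / 2 : ℝ) ^ k) (by linarith [half_pow_le_one k]) d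
  rw [← sub_eq_add_neg, ← missProb] at this
  linarith

/-- `κ` is a value of the parameter for which both answers are likely, and a wrong answer to the
question on which side of `κ` a parameter lies is exponentially unlikely in its distance. -/
structure IsThreshold (d κ : ℕ) : Prop where
  pos : 1 ≤ κ
  le : κ ≤ d + 1
  ge_quarter : ∀ k, κ ≤ k → 1 / 4 ≤ missProb d k
  lt_quarter : ∀ k, k < κ → missProb d k < 1 / 4
  le_two_thirds : missProb d κ ≤ 2 / 3
  above : ∀ j, 1 - missProb d (κ + j) ≤ (2 / 3) ^ j
  below : ∀ j, j ≤ κ → missProb d (κ - j) ≤ (2 / 3) ^ j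

/-- Take the least `κ` at which a negative answer has probability at least `1 / 4`. Let `x` and `y`
be the probabilities at consecutive parameters, so `x ≤ y²`. From `κ` on, `y ≥ 1 / 2` and `1 - x ≥
(1 - y)(1 + y) ≥ (3 / 2)(1 - y)`; below `κ`, `y < 1 / 4` and `x ≤ y / 4`. -/
theorem exists_isThreshold {d : ℕ} (hd : 1 ≤ d) : ∃ κ, IsThreshold d κ := by
  have hex : 1 / 4 ≤ missProb d (d + 1) := by
    have h := one_sub_missProb_le d (d + 1)
    have h2 : (d : ℝ) ≤ 2 ^ d := by exact_mod_cast Nat.lt_two_pow_self.le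
    have h3 : (d : ℝ) * (1 / 2) ^ (d + 1) ≤ 1 / 2 := by
      rw [one_div, inv_pow, pow_succ, ← div_eq_mul_inv, div_le_iff₀ (by positivity)]
      linarith
    linarith
  classical
  have hP : ∃ k, 1 / 4 ≤ missProb d k := ⟨_, hex⟩
  set κ := Nat.find hP with hκ
  have spec : 1 / 4 ≤ missProb d κ := Nat.find_spec hP
  have lt : ∀ k, k < κ → missProb d k < 1 / 4 := fun k hk => not_le.1 (Nat.find_min hP hk)
  have pos : 1 ≤ κ := by
    by_contra h
    rw [show κ = 0 by omega, missProb_zero hd] at spec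
    norm_num at spec
  have ge : ∀ k, κ ≤ k → 1 / 4 ≤ missProb d k := fun k hk => spec.trans (missProb_mono d hk)
  refine ⟨κ, pos, Nat.find_min' hP hex, ge, lt, ?_, fun j => ?_, fun j hj => ?_⟩
  · obtain ⟨k, hk⟩ := Nat.exists_eq_add_of_le' pos
    rcases Nat.eq_zero_or_pos k with rfl | hk0
    · rw [hk]
      linarith [missProb_one hd]
    · have h1 := lt k (by omega)
      have h2 := missProb_succ_cube d hk0
      rw [hk]
      by_contra h
      have h3 := pow_lt_pow_left₀ (not_le.1 h) (by norm_num) (three_ne_zero)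
      norm_num at h3
      linarith
  · induction j with
    | zero => simpa using missProb_nonneg d κ
    | succ j ih =>
      have h1 := ge (κ + j) (by omega)
      have h2 := ge (κ + (j + 1)) (by omega)
      have h3 := missProb_succ_sq d (κ + j)
      have h4 := missProb_le_one d (κ + (j + 1))
      rw [pow_succ, add_assoc] at *
      have h5 : 1 / 2 ≤ missProb d (κ + (j + 1)) := by nlinarith
      nlinarith
  · induction j with
    | zero => simpa using missProb_le_one d κ
    | succ j ih =>
      have ih := ih (by omega)
      rcases Nat.eq_zero_or_pos j with rfl | hj0
      · linarith [lt (κ - (0 + 1)) (by omega)]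
      · have h1 := missProb_succ_sq d (κ - (j + 1))
        rw [show κ - (j + 1) + 1 = κ - j by omega] at h1
        have h2 := lt (κ - j) (by omega)
        have h3 := missProb_nonneg d (κ - j)
        rw [pow_succ]
        nlinarith

/-- The probability that a random test with parameter `k` misjudges on which side of `κ` it is. -/
noncomputable def errProb (d κ k : ℕ) : ℝ := if k < κ then missProb d k else 1 - missProb d k

theorem errProb_nonneg (d κ k : ℕ) : 0 ≤ errProb d κ k := by
  rw [errProb]
  split_ifs
  · exact missProb_nonneg d k
  · linarith [missProb_le_one d k]

/-- The expected displacement caused by a wrong answer to the random test with parameter `k`. -/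
noncomputable def errCost (d κ k : ℕ) : ℝ := errProb d κ k * |(k : ℝ) - κ|

theorem errCost_nonneg (d κ k : ℕ) : 0 ≤ errCost d κ k :=
  mul_nonneg (errProb_nonneg d κ k) (abs_nonneg _)

theorem sum_mul_two_thirds_pow_le (N : ℕ) :
    ∑ x ∈ Finset.range N, (x : ℝ) * (2 / 3) ^ x ≤ 6 := by
  have : ∑ x ∈ Finset.range N, (x : ℝ) * (2 / 3) ^ x = 6 - (3 * N + 6) * (2 / 3) ^ N := by
    induction N with
    | zero => norm_num
    | succ N ih =>
      rw [Finset.sum_range_succ, ih]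
      push_cast
      ring
  rw [this]
  have : (0 : ℝ) ≤ (3 * N + 6) * (2 / 3) ^ N := by positivity
  linarith

/-- Each side of `κ` is dominated by `∑ x (2/3)ˣ = 6`. This bound, independent of `d`, is why the
search may ask every question only once. -/
theorem IsThreshold.sum_errCost_le {d κ : ℕ} (h : IsThreshold d κ) (S : Finset ℕ) :
    ∑ k ∈ S, errCost d κ k ≤ 12 := by
  obtain ⟨N, hN⟩ := S.exists_nat_subset_range
  refine (Finset.sum_le_sum_of_subset_of_nonneg (hN.trans (Finset.range_mono
    (Nat.le_add_left N κ))) fun _ _ _ => errCost_nonneg _ _ _).trans ?_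
  rw [Finset.sum_range_add]
  have h1 : ∑ x ∈ Finset.range κ, errCost d κ x ≤ 6 := by
    rw [← Finset.sum_range_reflect]
    have h0 := sum_mul_two_thirds_pow_le (κ + 1)
    rw [Finset.sum_range_succ', Nat.cast_zero, zero_mul, add_zero] at h0
    refine (Finset.sum_le_sum fun j hj => ?_).trans h0
    rw [Finset.mem_range] at hj
    have hb := h.below (j + 1) (by omega)
    rw [errCost, errProb, if_pos (by omega), show κ - 1 - j = κ - (j + 1) by omega,
      Nat.cast_sub (by omega), sub_sub_cancel_left, abs_neg, Nat.abs_cast, mul_comm]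
    exact mul_le_mul_of_nonneg_left hb (by positivity)
  have h2 : ∑ x ∈ Finset.range N, errCost d κ (κ + x) ≤ 6 := by
    refine (Finset.sum_le_sum fun j hj => ?_).trans (sum_mul_two_thirds_pow_le N)
    rw [errCost, errProb, if_neg (by omega), Nat.cast_add, add_sub_cancel_left, Nat.abs_cast,
      mul_comm]
    exact mul_le_mul_of_nonneg_left (h.above j) (by positivity)
  linarith

end GroupTesting

/-! ### Searching the threshold with unrepeated tests -/

namespace GroupTesting

/-- A command without effect on the registers that matter. -/
def skip : Prog := .assign 4 (.const 0)

/-- From `t` to `t + 1`: register `5` holds `t`, register `6` holds `2 ^ t ^ 2`, and register `7`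
holds `2 ^ (2 * t + 1)`. -/
def gallopGrow : Prog :=
  .seq (.assign 6 (.mul (.reg 6) (.reg 7)))
    (.seq (.assign 7 (.mul (.reg 7) (.const 4))) (.assign 5 (.add (.reg 5) (.const 1))))

/-- Register `1` is both the last answer and the flag for going on; it is cleared when the parameter
exceeds the number of items. -/
def gallopStep : Prog :=
  .ite (.const 1) (.reg 1)
    (.seq (.assign 10 (.reg 6)) (.seq randomTest
      (.ite (.const 1) (.reg 1) (.ite (.reg 6) (.reg 0) gallopGrow (.assign 1 (.const 0))) skip)))
    skip

/-- Make random tests with the parameters `2 ^ t ^ 2` for `t = 0, 1, …`, until the answer is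
negative or the parameter exceeds the number of items. -/
def gallop : Prog :=
  .seq (.assign 1 (.const 1)) (.seq (.assign 5 (.const 0)) (.seq (.assign 6 (.const 1))
    (.seq (.assign 7 (.const 2)) (.loop (.add (.reg 0) (.const 1)) gallopStep))))

/-- A positive answer suggests that the parameter is below the threshold, so the lower end moves up.
-/
def bisectStep : Prog :=
  .seq (.assign 9 (.div (.reg 9) (.const 2))) (.seq (.assign 10 (.add (.reg 8) (.reg 9)))
    (.seq randomTest (.ite (.const 1) (.reg 1) (.assign 8 (.reg 10)) skip)))

/-- Bisect the interval from `0` to the content of register `6`; the lower end of the final interval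
of length `1` is in register `8`. -/
def bisect : Prog :=
  .seq (.assign 8 (.const 0)) (.seq (.assign 9 (.reg 6))
    (.loop (.mul (.reg 5) (.reg 5)) bisectStep))

/-- Find a parameter for which both answers are likely, and store it in register `10`. -/
def search : Prog := .seq gallop (.seq bisect (.assign 10 (.add (.reg 8) (.const 1))))

/-- A bound for the expected number of tests of `search` after `t` rounds of `gallop`, when
positive answers have probability at most `1 / 4` from round `t₁` on. -/
noncomputable def searchCost (t₁ t : ℕ) : ℝ :=
  if t ≤ t₁ then t₁ ^ 2 + t₁ + 2 + (t₁ - t) else t ^ 2 + t + 2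

theorem sq_le_searchCost (t₁ t : ℕ) : (t : ℝ) ^ 2 + t + 2 ≤ searchCost t₁ t := by
  rw [searchCost]
  split_ifs with h
  · have : (t : ℝ) ≤ t₁ := by exact_mod_cast h
    nlinarith [t.cast_nonneg (α := ℝ)]
  · exact le_rfl

/-- Before `t₁` going on is the worse case, and it costs exactly one test. From `t₁` on, another
round raises the bound by `3t + 4`, but with probability at most `1 / 4`, and `1 + (3t + 4) / 4 ≤ t
+ 2`. -/
theorem searchCost_step {t₁ t : ℕ} {z : ℝ} (h0 : 0 ≤ z) (h : t₁ ≤ t → 1 - z ≤ 1 / 4) :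
    z * (1 + (t : ℝ) ^ 2) + (1 - z) * (1 + searchCost t₁ (t + 1)) ≤ searchCost t₁ t := by
  rcases lt_or_ge t t₁ with ht | ht
  · have h2 := sq_le_searchCost t₁ (t + 1)
    have h3 : searchCost t₁ t = 1 + searchCost t₁ (t + 1) := by
      rw [searchCost, searchCost, if_pos ht.le, if_pos (Nat.succ_le_of_lt ht)]
      push_cast
      ring
    push_cast at h2
    have h4 := mul_nonneg h0 (sub_nonneg.2 ((show (t : ℝ) ^ 2 ≤ (t + 1) ^ 2 + (t + 1) + 2 by
      nlinarith [t.cast_nonneg (α := ℝ)]).trans h2))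
    rw [h3]
    linarith
  · have h2 : searchCost t₁ (t + 1) = (t + 1) ^ 2 + (t + 1) + 2 := by
      rw [searchCost, if_neg (by omega)]
      push_cast
      ring
    have h3 := sq_le_searchCost t₁ t
    have h4 := mul_le_mul_of_nonneg_right (h ht) (show 0 ≤ 3 * (t : ℝ) + 4 by positivity)
    rw [h2]
    nlinarith [t.cast_nonneg (α := ℝ)]

variable {n : ℕ} {I : Finset (Fin n)} {κ t₁ : ℕ} {u v : ℝ}

/-- Stopping at `K < κ` is an error with displacement `κ - K`, so its expected damage is the term of
index `K`; the strict growth of the parameter ensures that no term is charged twice. -/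
theorem gallop_displacement_step {d κ K K' : ℕ} (hK : K < K') :
    missProb d K * max ((κ : ℝ) - K) 0 + (1 - missProb d K) * ∑ j ∈ Finset.Ico K' κ, errCost d κ j ≤
      ∑ j ∈ Finset.Ico K κ, errCost d κ j := by
  have h0 := missProb_nonneg d K
  have h1 := missProb_le_one d K
  have hs : 0 ≤ ∑ j ∈ Finset.Ico K' κ, errCost d κ j :=
    Finset.sum_nonneg fun _ _ => errCost_nonneg _ _ _
  rcases lt_or_ge K κ with h | h
  · have h2 : ∑ j ∈ Finset.Ico K' κ, errCost d κ j ≤ ∑ j ∈ Finset.Ico (K + 1) κ, errCost d κ j :=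
      Finset.sum_le_sum_of_subset_of_nonneg (Finset.Ico_subset_Ico_left hK)
        fun _ _ _ => errCost_nonneg _ _ _
    have h3 : (K : ℝ) < κ := by exact_mod_cast h
    rw [Finset.sum_eq_sum_Ico_succ_bot h, errCost, errProb, if_pos h, abs_sub_comm,
      abs_of_pos (by linarith), max_eq_left (by linarith)]
    nlinarith
  · have h3 : (κ : ℝ) ≤ K := by exact_mod_cast h
    rw [Finset.Ico_eq_empty_of_le h, Finset.Ico_eq_empty_of_le (h.trans hK.le),
      max_eq_right (by linarith)]
    simp

/-- The weights `u` for tests and `v` for displacement stay free, so that one argument serves both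
the test count and the failure probability. -/
theorem expLE_gallop (hκ : IsThreshold I.card κ)
    (ht₁ : ∀ t, t₁ ≤ t → 1 - missProb I.card (2 ^ t ^ 2) ≤ 1 / 4) (hu : 0 ≤ u) (hv : 0 ≤ v)
    (s : State n) (hn : s.reg 0 = n) :
    ExpLE (gallop.run I s) (fun s' => s'.reg 0 = n ∧ s'.reg 6 = 2 ^ s'.reg 5 ^ 2)
      (fun s' => u * (s'.asked + (s'.reg 5 : ℝ) ^ 2) + v * max ((κ : ℝ) - s'.reg 6) 0)
      (u * (s.asked + searchCost t₁ 0) + v * 12) := by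
  have hκn : κ ≤ n + 1 := hκ.le.trans (by simpa using Finset.card_le_univ I)
  set S : ℕ → ℝ := fun K => ∑ j ∈ Finset.Ico K κ, errCost I.card κ j with hS
  have S0 : ∀ K, 0 ≤ S K := fun K => Finset.sum_nonneg fun _ _ => errCost_nonneg _ _ _
  refine ExpLE.assign_seq fun _ => ExpLE.assign_seq fun _ => ExpLE.assign_seq fun _ =>
    ExpLE.assign_seq fun _ => ExpLE.loop (n + 1) ?_
    (fun i s' => s'.reg 0 = n ∧ s'.reg 6 = 2 ^ s'.reg 5 ^ 2 ∧ s'.reg 7 = 2 ^ (2 * s'.reg 5 + 1) ∧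
      (s'.reg 1 = 0 ∨ s'.reg 1 = 1 ∧ s'.reg 5 = i ∧ (i = 0 ∨ 2 ^ (i - 1) ^ 2 ≤ n)))
    (fun i s' => if s'.reg 1 = 0 then
      u * (s'.asked + (s'.reg 5 : ℝ) ^ 2) + v * max ((κ : ℝ) - s'.reg 6) 0
      else u * (s'.asked + searchCost t₁ (s'.reg 5)) + v * S (s'.reg 6)) ?_ ?_ ?_ ?_ ?_
  · simp [Expr.eval, Function.update, hn]
  · intro τ
    simp [Expr.eval, Function.update, hn]
  · intro τ
    have := hκ.sum_errCost_le (Finset.Ico 1 κ)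
    have := mul_le_mul_of_nonneg_left this hv
    simp [Expr.eval, Function.update, hS]
    linarith
  · rintro i - t ⟨h0, h6, h7, h1⟩
    rcases h1 with h1 | ⟨h1, h5, hi⟩
    · refine ExpLE.ite (fun _ h => ?_) (fun _ _ => ExpLE.assign fun _ => ?_)
      · simp [Expr.eval, h1] at h
      · simp [h0, h6, h7, h1]
    refine ExpLE.ite (fun _ _ => ExpLE.assign_seq fun _ => ?_) (fun _ h => ?_)
    swap
    · simp [Expr.eval, h1] at h
    set T := t.reg 5 with hT
    have h6' : t.reg 6 = 2 ^ T ^ 2 := h6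
    set A : ℝ := u * (t.asked + 1 + (T : ℝ) ^ 2) + v * max ((κ : ℝ) - t.reg 6) 0 with hA
    set B : ℝ := u * (t.asked + 1 + searchCost t₁ (T + 1)) + v * S (t.reg 6 * t.reg 7) with hB
    have c1 := sq_le_searchCost t₁ (T + 1)
    have c2 : 0 ≤ searchCost t₁ (T + 1) := le_trans (by positivity) c1
    have hAB : missProb I.card (t.reg 6) * A + (1 - missProb I.card (t.reg 6)) * B ≤
        u * (t.asked + searchCost t₁ T) + v * S (t.reg 6) := by
      have e1 := mul_le_mul_of_nonneg_left (searchCost_step (t₁ := t₁) (t := T)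
        (missProb_nonneg I.card (t.reg 6)) (by rw [h6']; exact ht₁ T)) hu
      have hlt : t.reg 6 < t.reg 6 * t.reg 7 := by
        rw [h6', h7]
        exact lt_mul_of_one_lt_right (by positivity) (Nat.one_lt_two_pow (by omega))
      have e2 := mul_le_mul_of_nonneg_left
        (gallop_displacement_step (d := I.card) (κ := κ) hlt) hv
      simp only [hA, hB, hS]
      linarith
    rw [h1, if_neg one_ne_zero]
    refine ExpLE.mono (ExpLE.seq (expLE_randomTest _ ?_ (A := A) (B := B) ?_ ?_)
      fun t' ht' => ?_) (fun _ h => h) (fun _ _ => le_rfl) ?_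
    · simp [h0]
    · exact add_nonneg (mul_nonneg hu (by positivity)) (mul_nonneg hv (le_max_right _ _))
    · exact add_nonneg (mul_nonneg hu (by positivity)) (mul_nonneg hv (S0 _))
    rotate_left
    · simpa [Expr.eval] using hAB
    obtain ⟨f, ha, h⟩ := ht'
    have f0 : t'.reg 0 = n := by simpa [h0] using f 0 (by norm_num)
    have f5 : t'.reg 5 = T := by simpa using f 5 (by norm_num)
    have f6 : t'.reg 6 = t.reg 6 := by simpa using f 6 (by norm_num)
    have f7 : t'.reg 7 = t.reg 7 := by simpa using f 7 (by norm_num)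
    replace ha : t'.asked = t.asked + 1 := ha
    refine ExpLE.ite (fun _ hb => ExpLE.ite (fun _ hle => ?_) (fun _ hle => ?_)) (fun _ hb => ?_)
    · replace h : t'.reg 1 = 1 := by simp [Expr.eval] at hb; omega
      refine ExpLE.assign_seq fun _ => ExpLE.assign_seq fun _ => ExpLE.assign fun _ => ?_
      simp [Expr.eval, Function.update, h, f0, f5, f6, f7, ha, h7, hB]
      refine ⟨?_, ?_, h5, ?_⟩
      · rw [h6', ← pow_add]
        congr 1
        ring
      · rw [show 4 = 2 ^ 2 by norm_num, ← pow_add]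
        congr 1
      · rw [← h5, ← h6', ← f6]
        simpa [Expr.eval, f0] using hle
    · replace h : t'.reg 1 = 1 := by simp [Expr.eval] at hb; omega
      simp only [Expr.eval, f6, f0, not_le] at hle
      -- Stopping because the parameter exceeds `n` is harmless: it is then at least `n + 1 ≥ κ`, so
      -- there is no displacement.
      have hκ' : (κ : ℝ) ≤ t.reg 6 := by exact_mod_cast hκn.trans hle
      refine ExpLE.assign fun _ => ?_
      simp only [Expr.eval, Function.update, h, f0, f5, f6, f7, ha, h7, hB]
      refine ⟨by simpa using h6', ?_⟩
      push_cast
      have := mul_le_mul_of_nonneg_left (show (T : ℝ) ^ 2 ≤ searchCost t₁ (T + 1) by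
        push_cast at c1
        nlinarith [T.cast_nonneg (α := ℝ)]) hu
      have := mul_nonneg hv (S0 (t.reg 6 * t.reg 7))
      rw [h7] at this
      simp [max_eq_right (sub_nonpos.2 hκ')]
      linarith
    · replace h : t'.reg 1 = 0 := by simp [Expr.eval] at hb; omega
      refine ExpLE.assign fun _ => ?_
      simp [Function.update, h, f0, f5, f6, f7, ha, h7, hA, h6']
  · rintro t ⟨h0, h6, -, -⟩
    exact ⟨h0, h6⟩
  · rintro t ⟨h0, h6, -, h⟩
    rcases h with h | ⟨-, -, h⟩
    · rw [if_pos h]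
    -- The gallop cannot still be running after `n + 1` rounds, since that would require `2 ^ n ^ 2
    -- ≤ n`.
    · exfalso
      rcases h with h | h
      · omega
      · have h2 : n < 2 ^ n := Nat.lt_two_pow_self
        have h3 : 2 ^ n ≤ 2 ^ n ^ 2 := Nat.pow_le_pow_right (by norm_num) (by nlinarith [sq_nonneg n, Nat.le_self_pow two_ne_zero n])
        simp at h
        omega

/-- The distance of `κ` from the interval of length `w` with lower end `lo`. -/
noncomputable def intervalDist (κ lo w : ℕ) : ℝ := max (max ((lo : ℝ) - κ) (κ - lo - w)) 0

/-- The correct half is as far from `κ` as the whole interval, and the wrong half is at distance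
exactly `|lo + w - κ|`. The interior points split into the midpoint and the interiors of the two
halves, so each parameter is charged at most once. -/
theorem bisect_displacement_step {d lo w : ℕ} (hw : 1 ≤ w) :
    missProb d (lo + w) * (intervalDist κ lo w +
        ∑ j ∈ Finset.Ico (lo + 1) (lo + w), errCost d κ j) +
      (1 - missProb d (lo + w)) * (intervalDist κ (lo + w) w +
        ∑ j ∈ Finset.Ico (lo + w + 1) (lo + w + w), errCost d κ j) ≤
    intervalDist κ lo (2 * w) + ∑ j ∈ Finset.Ico (lo + 1) (lo + 2 * w), errCost d κ j := by
  have h0 := missProb_nonneg d (lo + w)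
  have h1 := missProb_le_one d (lo + w)
  have s1 : 0 ≤ ∑ j ∈ Finset.Ico (lo + 1) (lo + w), errCost d κ j :=
    Finset.sum_nonneg fun _ _ => errCost_nonneg _ _ _
  have s2 : 0 ≤ ∑ j ∈ Finset.Ico (lo + w + 1) (lo + w + w), errCost d κ j :=
    Finset.sum_nonneg fun _ _ => errCost_nonneg _ _ _
  have hw' : (0 : ℝ) ≤ w := w.cast_nonneg
  rw [show lo + 2 * w = lo + w + w by ring, ← Finset.sum_Ico_consecutive _
    (show lo + 1 ≤ lo + w by omega) (show lo + w ≤ lo + w + w by omega),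
    Finset.sum_eq_sum_Ico_succ_bot (show lo + w < lo + w + w by omega)]
  set S₁ := ∑ j ∈ Finset.Ico (lo + 1) (lo + w), errCost d κ j
  set S₂ := ∑ j ∈ Finset.Ico (lo + w + 1) (lo + w + w), errCost d κ j
  have hd : 0 ≤ intervalDist κ lo (2 * w) := le_max_right _ _
  rw [errCost, errProb]
  split_ifs with h
  · have h' : ((lo + w : ℕ) : ℝ) < κ := by exact_mod_cast h
    have e1 : intervalDist κ (lo + w) w = intervalDist κ lo (2 * w) := by
      rw [intervalDist, intervalDist]
      push_cast at h' ⊢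
      rw [max_assoc, max_assoc, max_eq_right, max_eq_right (a := (lo : ℝ) - κ)]
      · congr 1
        ring
      · exact le_max_of_le_right (by linarith)
      · exact le_max_of_le_right (by linarith)
    have e2 : intervalDist κ lo w = |((lo + w : ℕ) : ℝ) - κ| := by
      rw [intervalDist, abs_sub_comm, abs_of_pos (by linarith)]
      push_cast at h' ⊢
      rw [max_eq_right (a := (lo : ℝ) - κ) (by linarith), max_eq_left (by linarith)]
      ring
    rw [e1, e2]
    nlinarith [mul_nonneg h0 s2, mul_nonneg (sub_nonneg.2 h1) s1, mul_nonneg h0 hd]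
  · have h' : (κ : ℝ) ≤ ((lo + w : ℕ) : ℝ) := by exact_mod_cast not_lt.1 h
    have e1 : intervalDist κ lo w = intervalDist κ lo (2 * w) := by
      rw [intervalDist, intervalDist]
      push_cast at h' ⊢
      rw [max_assoc, max_assoc, max_eq_right (a := (κ : ℝ) - lo - w) (by linarith),
        max_eq_right (a := (κ : ℝ) - lo - 2 * w) (by linarith)]
    have e2 : intervalDist κ (lo + w) w = |((lo + w : ℕ) : ℝ) - κ| := by
      rw [intervalDist, abs_of_nonneg (by linarith)]
      push_cast at h' ⊢
      rw [max_eq_left (a := (lo : ℝ) + w - κ) (by linarith), max_eq_left (by linarith)]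
    rw [e1, e2]
    nlinarith [mul_nonneg h0 s2, mul_nonneg (sub_nonneg.2 h1) s1,
      mul_nonneg (sub_nonneg.2 h1) hd]

theorem expLE_bisect (hκ : IsThreshold I.card κ) (hu : 0 ≤ u) (hv : 0 ≤ v)
    (s : State n) (hn : s.reg 0 = n) (h6 : s.reg 6 = 2 ^ s.reg 5 ^ 2) :
    ExpLE (bisect.run I s) (fun s' => s'.reg 0 = n)
      (fun s' => u * s'.asked + v * |((s'.reg 8 + 1 : ℕ) : ℝ) - κ|)
      (u * (s.asked + (s.reg 5 : ℝ) ^ 2) + v * max ((κ : ℝ) - s.reg 6) 0 + v * 13) := by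
  set T := s.reg 5 with hT
  set S : ℕ → ℕ → ℝ := fun lo w => ∑ j ∈ Finset.Ico (lo + 1) (lo + w), errCost I.card κ j with hS
  have S0 : ∀ lo w, 0 ≤ S lo w := fun _ _ => Finset.sum_nonneg fun _ _ => errCost_nonneg _ _ _
  have D0 : ∀ lo w, 0 ≤ intervalDist κ lo w := fun _ _ => le_max_right _ _
  refine ExpLE.assign_seq fun _ => ExpLE.assign_seq fun _ => ExpLE.loop (T ^ 2) ?_
    (fun i s' => s'.reg 0 = n ∧ s'.reg 9 = 2 ^ (T ^ 2 - i))
    (fun i s' => u * (s'.asked + (T ^ 2 - i)) +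
      v * (intervalDist κ (s'.reg 8) (s'.reg 9) + S (s'.reg 8) (s'.reg 9) + 1)) ?_ ?_ ?_ ?_ ?_
  · simp [Expr.eval, Function.update, ← hT, sq]
  · intro τ
    simp [Expr.eval, Function.update, hn, h6]
  · intro τ
    have := hκ.sum_errCost_le (Finset.Ico 1 (s.reg 6))
    have := mul_le_mul_of_nonneg_left this hv
    have hd : intervalDist κ 0 (s.reg 6) = max ((κ : ℝ) - s.reg 6) 0 := by
      rw [intervalDist, max_assoc, max_eq_right]
      · simp
      · exact le_max_of_le_right (by simp)
    simp [Expr.eval, Function.update, hS, hd]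
    linarith
  · rintro i hi t ⟨h0, h9⟩
    set w := 2 ^ (T ^ 2 - (i + 1)) with hw
    have hw1 : 1 ≤ w := Nat.one_le_two_pow
    have h9' : t.reg 9 = 2 * w := by
      rw [h9, hw, ← pow_succ']
      congr 1
      omega
    set lo := t.reg 8 with hlo
    set c : ℝ := t.asked + 1 + (T ^ 2 - (i + 1)) with hc
    have hc0 : 0 ≤ c := by
      have : ((i + 1 : ℕ) : ℝ) ≤ (T ^ 2 : ℕ) := by exact_mod_cast hi
      push_cast at this
      have := (t.asked).cast_nonneg (α := ℝ)
      linarith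
    refine ExpLE.assign_seq fun _ => ExpLE.assign_seq fun _ => ?_
    refine ExpLE.mono (ExpLE.seq (expLE_randomTest _ ?_
      (A := u * c + v * (intervalDist κ lo w + S lo w + 1))
      (B := u * c + v * (intervalDist κ (lo + w) w + S (lo + w) w + 1)) ?_ ?_)
      fun t' ht' => ?_) (fun _ h => h) (fun _ _ => le_rfl) ?_
    · simpa [Function.update] using h0
    · have := D0 lo w
      have := S0 lo w
      positivity
    · have := D0 (lo + w) w
      have := S0 (lo + w) w
      positivity
    · obtain ⟨f, ha, h⟩ := ht'
      have f0 : t'.reg 0 = n := by simpa [Function.update, h0] using f 0 (by norm_num)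
      have f8 : t'.reg 8 = lo := by simpa [Function.update] using f 8 (by norm_num)
      have f9 : t'.reg 9 = w := by simpa [Function.update, Expr.eval, h9'] using f 9 (by norm_num)
      have f10 : t'.reg 10 = lo + w := by
        simpa [Function.update, Expr.eval, h9', ← hlo] using f 10 (by norm_num)
      replace ha : t'.asked = t.asked + 1 := ha
      refine ExpLE.ite (fun _ hb => ?_) (fun _ hb => ?_)
      · replace h : t'.reg 1 = 1 := by simp [Expr.eval] at hb; omega
        refine ExpLE.assign fun _ => ?_
        simp [Expr.eval, Function.update, h, f0, f9, f10, ha, hc]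
      · replace h : t'.reg 1 = 0 := by simp [Expr.eval] at hb; omega
        refine ExpLE.assign fun _ => ?_
        simp [Function.update, h, f0, f8, f9, ha, hc]
    · have := mul_le_mul_of_nonneg_left
        (bisect_displacement_step (κ := κ) (d := I.card) (lo := lo) hw1) hv
      simp [Expr.eval, Function.update, ← hlo, h9', hc, hS]
      linarith
  · rintro t ⟨h0, -⟩
    exact h0
  · rintro t ⟨h0, h9⟩
    rw [Nat.sub_self, pow_zero] at h9
    -- The final interval has length `1`, so its upper end may lie one farther from `κ` than the
    -- interval does; with the constant `12` for errors this makes `13`.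
    have e : |((t.reg 8 + 1 : ℕ) : ℝ) - κ| ≤ intervalDist κ (t.reg 8) 1 + 1 := by
      rw [intervalDist]
      push_cast
      refine abs_le.2 ⟨?_, ?_⟩
      · linarith [(le_max_right _ _).trans (le_max_left (max ((t.reg 8 : ℝ) - κ) (κ - t.reg 8 - 1)) 0)]
      · linarith [(le_max_left _ _).trans (le_max_left (max ((t.reg 8 : ℝ) - κ) (κ - t.reg 8 - 1)) 0)]
    have := mul_le_mul_of_nonneg_left e hv
    have := mul_nonneg hv (S0 (t.reg 8) 1)
    rw [h9]
    push_cast at *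
    linarith

theorem expLE_search (hκ : IsThreshold I.card κ)
    (ht₁ : ∀ t, t₁ ≤ t → 1 - missProb I.card (2 ^ t ^ 2) ≤ 1 / 4) (hu : 0 ≤ u) (hv : 0 ≤ v)
    (s : State n) (hn : s.reg 0 = n) :
    ExpLE (search.run I s) (fun s' => s'.reg 0 = n)
      (fun s' => u * s'.asked + v * |(s'.reg 10 : ℝ) - κ|)
      (u * (s.asked + searchCost t₁ 0) + v * 25) := by
  have h := expLE_gallop hκ ht₁ hu hv s hn
  have h' : ExpLE (gallop.run I s) (fun s' => s'.reg 0 = n ∧ s'.reg 6 = 2 ^ s'.reg 5 ^ 2)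
      (fun s' => u * (s'.asked + (s'.reg 5 : ℝ) ^ 2) + v * max ((κ : ℝ) - s'.reg 6) 0 + v * 13)
      (u * (s.asked + searchCost t₁ 0) + v * 25) := by
    have := sq_le_searchCost t₁ 0
    have h0 : 0 ≤ searchCost t₁ 0 := le_trans (by positivity) this
    exact (h.add_const (by positivity) (by positivity : 0 ≤ v * 13)).mono (fun _ h => h)
      (fun _ _ => le_rfl) (by linarith)
  refine ExpLE.seq h' fun t ht => ExpLE.seq (expLE_bisect hκ hu hv t ht.1 ht.2) fun t' ht' =>
    ExpLE.assign fun _ => ?_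
  simp [Expr.eval, Function.update, ht']

end GroupTesting

/-! ### Correcting the parameter by a walk -/

namespace GroupTesting

/-- One step of the walk: `m` random tests; move the parameter in register `10` up if fewer than
an eighth of the answers are negative, down if more than three quarters are, and set
register `12` otherwise. -/
def walkStep (m : ℕ) : Prog :=
  .ite (.const 1) (.reg 12) skip (.seq (measure m)
    (.ite (.add (.mul (.const 8) (.reg 11)) (.const 1)) (.const m)
      (.assign 10 (.add (.reg 10) (.const 1)))
      (.ite (.const (3 * m + 1)) (.mul (.const 4) (.reg 11))
        (.assign 10 (.sub (.reg 10) (.const 1))) (.assign 12 (.const 1)))))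

/-- The number of rounds exceeds the distance of register `10` from any possible threshold, since `κ
≤ n + 1`. -/
def walk (m : ℕ) : Prog :=
  .seq (.assign 12 (.const 0))
    (.loop (.add (.add (.reg 10) (.reg 0)) (.const 5)) (walkStep m))

/-- The number `Z` of negative answers among `m` random tests with parameter `k` is close to its
mean. -/
def Accurate (α : ℝ) (m d k Z : ℕ) : Prop := |(Z : ℝ) - m * missProb d k| ≤ α * m

variable {n : ℕ} {I : Finset (Fin n)} {κ m d : ℕ} {α : ℝ}

/-- The cutoffs `1 / 8` and `3 / 4` leave a margin above `α` to the bounds `1 / 4` and `2 / 3` at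
the threshold. So an accurate measurement never moves away from `κ`, and it stops at `κ`. -/
theorem Accurate.lt_of_few (hκ : IsThreshold d κ) {k Z : ℕ} (h : Accurate α m d k Z)
    (hα : α ≤ 1 / 100) (hZ : 8 * Z + 1 ≤ m) : k < κ := by
  by_contra hk
  have h1 := hκ.ge_quarter k (not_lt.1 hk)
  have h2 := (abs_le.1 h).1
  have h3 : (8 * Z + 1 : ℝ) ≤ m := by exact_mod_cast hZ
  nlinarith [m.cast_nonneg (α := ℝ)]

theorem Accurate.lt_of_many (hκ : IsThreshold d κ) {k Z : ℕ} (h : Accurate α m d k Z)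
    (hα : α ≤ 1 / 100) (hZ : 3 * m + 1 ≤ 4 * Z) : κ < k := by
  by_contra hk
  have h1 := (missProb_mono d (not_lt.1 hk)).trans hκ.le_two_thirds
  have h2 := (abs_le.1 h).2
  have h3 : (3 * m + 1 : ℝ) ≤ 4 * Z := by exact_mod_cast hZ
  nlinarith [m.cast_nonneg (α := ℝ)]

/-- Shared by the two analyses of the walk: `A` bounds the next potential after an accurate
measurement, and `A + B` after any measurement. -/
theorem expLE_walkStep (hκ : IsThreshold I.card κ) (hα : 0 < α) (hα1 : α ≤ 1 / 100)
    (s : State n) (hn : s.reg 0 = n) (h12 : s.reg 12 = 0) {F : State n → ℝ} {A B : ℝ}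
    (hA : 0 ≤ A) (hB : 0 ≤ B)
    (hup : ∀ t : State n, t.reg 12 = 0 → t.asked = s.asked + m → t.reg 10 = s.reg 10 + 1 →
      F t ≤ A + B)
    (hup' : ∀ t : State n, t.reg 12 = 0 → t.asked = s.asked + m → t.reg 10 = s.reg 10 + 1 →
      s.reg 10 < κ → F t ≤ A)
    (hdown : ∀ t : State n, t.reg 12 = 0 → t.asked = s.asked + m → t.reg 10 = s.reg 10 - 1 →
      F t ≤ A + B)
    (hdown' : ∀ t : State n, t.reg 12 = 0 → t.asked = s.asked + m → t.reg 10 = s.reg 10 - 1 →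
      κ < s.reg 10 → F t ≤ A)
    (hdone : ∀ t : State n, t.reg 12 = 1 → t.asked = s.asked + m → t.reg 10 = s.reg 10 →
      F t ≤ A + B)
    (hdone' : ∀ t : State n, t.reg 12 = 1 → t.asked = s.asked + m → t.reg 10 = s.reg 10 →
      Accurate α m I.card (t.reg 10) (t.reg 11) → m ≤ 8 * t.reg 11 → 4 * t.reg 11 ≤ 3 * m →
      F t ≤ A) :
    ExpLE ((walkStep m).run I s)
      (fun t => t.reg 0 = n ∧ (t.reg 12 = 0 ∨ t.reg 12 = 1)) F
      (A + B * (2 * Real.exp (-(m * α ^ 2 / 4)))) := by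
  refine ExpLE.ite (fun _ h => ?_) fun τ _ => ?_
  · simp [Expr.eval, h12] at h
  have hmeas := expLE_measure (I := I) m ⟨s.reg, s.query, s.asked, τ⟩ hn hA hB hα (by linarith)
  refine ExpLE.seq hmeas ?_
  rintro t ⟨f, ha⟩
  have f0 : t.reg 0 = n := by rw [f 0 (by norm_num), hn]
  have f10 : t.reg 10 = s.reg 10 := f 10 (by norm_num)
  have f12 : t.reg 12 = 0 := by rw [f 12 (by norm_num), h12]
  replace ha : t.asked = s.asked + m := ha
  dsimp only
  set acc := |(t.reg 11 : ℝ) - m * missProb I.card (s.reg 10)| ≤ α * m with hacc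
  have hacc' : acc → Accurate α m I.card (s.reg 10) (t.reg 11) := fun h => h
  refine ExpLE.ite (fun _ h1 => ExpLE.assign fun _ => ?_) (fun _ h1 => ExpLE.ite
    (fun _ h2 => ExpLE.assign fun _ => ?_) (fun _ h2 => ExpLE.assign fun _ => ?_))
  all_goals
    refine ⟨by simp [Function.update, Expr.eval, f0, f12], ?_⟩
    simp only [Expr.eval] at *
  · split_ifs with h
    · exact hup' _ (by simp [f12]) ha (by simp [f10]) ((hacc' h).lt_of_few hκ hα1 h1)
    · exact hup _ (by simp [f12]) ha (by simp [f10])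
  · split_ifs with h
    · exact hdown' _ (by simp [f12]) ha (by simp [f10]) ((hacc' h).lt_of_many hκ hα1 h2)
    · exact hdown _ (by simp [f12]) ha (by simp [f10])
  · split_ifs with h
    · refine hdone' _ (by simp) ha (by simp [f10]) ?_ ?_ ?_
      · simpa [f10] using hacc' h
      · simp
        omega
      · simp
        omega
    · exact hdone _ (by simp) ha (by simp [f10])

theorem abs_succ_sub_le (k κ : ℕ) : |((k + 1 : ℕ) : ℝ) - κ| ≤ |(k : ℝ) - κ| + 1 := by
  push_cast
  rw [add_sub_right_comm]
  exact (abs_add_le _ _).trans (by simp)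

theorem abs_pred_sub_le (k κ : ℕ) : |((k - 1 : ℕ) : ℝ) - κ| ≤ |(k : ℝ) - κ| + 1 := by
  rcases Nat.eq_zero_or_pos k with rfl | hk
  · simp
  · rw [Nat.cast_sub hk, sub_right_comm]
    exact (abs_sub _ _).trans (by simp)

theorem abs_succ_sub_of_lt {k κ : ℕ} (h : k < κ) : |((k + 1 : ℕ) : ℝ) - κ| = |(k : ℝ) - κ| - 1 := by
  have : ((k + 1 : ℕ) : ℝ) ≤ κ := by exact_mod_cast h
  rw [abs_of_nonpos (by linarith)]
  push_cast at *
  rw [abs_of_nonpos (by linarith)]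
  ring

theorem abs_pred_sub_of_lt {k κ : ℕ} (h : κ < k) : |((k - 1 : ℕ) : ℝ) - κ| = |(k : ℝ) - κ| - 1 := by
  have : ((κ + 1 : ℕ) : ℝ) ≤ k := by exact_mod_cast h
  push_cast at *
  rw [Nat.cast_sub (by omega), Nat.cast_one, abs_of_nonneg (by linarith),
    abs_of_nonneg (by linarith)]
  ring

/-- Negative drift: an accurate step costs `m` tests and either stops or lowers the distance by one,
which releases `2m`. -/
theorem expLE_walk_asked (hκ : IsThreshold I.card κ) (hα : 0 < α) (hα1 : α ≤ 1 / 100)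
    (hm : 2 * Real.exp (-(m * α ^ 2 / 4)) ≤ 1 / 4) (s : State n) (hn : s.reg 0 = n) :
    ExpLE ((walk m).run I s) (fun t => t.reg 0 = n) (fun t => t.asked)
      (s.asked + m * (2 * |(s.reg 10 : ℝ) - κ| + 2)) := by
  have hm0 : (0 : ℝ) ≤ m := m.cast_nonneg
  refine ExpLE.assign_seq fun _ => ExpLE.loop _ rfl
    (fun _ t => t.reg 0 = n ∧ (t.reg 12 = 0 ∨ t.reg 12 = 1))
    (fun _ t => if t.reg 12 = 0 then t.asked + m * (2 * |(t.reg 10 : ℝ) - κ| + 2)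
      else (t.asked : ℝ)) ?_ ?_ ?_ ?_ ?_
  · intro τ
    simp [Function.update, hn, Expr.eval]
  · intro τ
    simp [Function.update, Expr.eval]
  · rintro i - t ⟨h0, h12⟩
    rcases h12 with h12 | h12
    · rw [if_pos h12]
      have hx := abs_nonneg ((t.reg 10 : ℝ) - κ)
      -- A wrong move leaves the distance two larger than a right one, hence `B = 4m`; at
      -- probability at most `1 / 4` it costs `m`, which the accurate case leaves free.
      refine ExpLE.mono (expLE_walkStep hκ hα hα1 t h0 h12
        (A := t.asked + m + m * (2 * |(t.reg 10 : ℝ) - κ|)) (B := 4 * m)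
        (by positivity) (by positivity) ?_ ?_ ?_ ?_ ?_ ?_) (fun _ h => h) (fun _ _ => le_rfl) ?_
      · intro t' g12 ga g10
        have := abs_succ_sub_le (t.reg 10) κ
        rw [if_pos g12, ga, g10]
        push_cast at *
        nlinarith
      · intro t' g12 ga g10 hlt
        rw [if_pos g12, ga, g10, abs_succ_sub_of_lt hlt]
        push_cast
        linarith
      · intro t' g12 ga g10
        have := abs_pred_sub_le (t.reg 10) κ
        rw [if_pos g12, ga, g10]
        push_cast at *
        nlinarith
      · intro t' g12 ga g10 hlt
        rw [if_pos g12, ga, g10, abs_pred_sub_of_lt hlt]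
        push_cast
        linarith
      · intro t' g12 ga _
        rw [if_neg (by omega), ga]
        push_cast
        nlinarith
      · intro t' g12 ga _ _ _ _
        rw [if_neg (by omega), ga]
        push_cast
        nlinarith
      · nlinarith
    · refine ExpLE.ite (fun _ _ => ExpLE.assign fun _ => ?_) (fun _ h => ?_)
      · simp [Function.update, h0, h12]
      · simp [Expr.eval, h12] at h
  · exact fun t h => h.1
  · intro t _
    split_ifs
    · have := abs_nonneg ((t.reg 10 : ℝ) - κ)
      have : 0 ≤ (m : ℝ) * (2 * |(t.reg 10 : ℝ) - κ| + 2) := by positivity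
      linarith
    · exact le_rfl

/-- The walk stopped, with accurate measurements and a fraction of negative answers that is neither
small nor large. -/
def GoodStop (α : ℝ) (m d : ℕ) (r : ℕ → ℕ) : Prop :=
  r 12 = 1 ∧ Accurate α m d (r 10) (r 11) ∧ m ≤ 8 * r 11 ∧ 4 * r 11 ≤ 3 * m

-- A union bound over a random number of measurements: if all of them are accurate, the walk stops
-- after at most `|k - κ| + 1`.
open Classical in
theorem expLE_walk_fail (hκ : IsThreshold I.card κ) (hα : 0 < α) (hα1 : α ≤ 1 / 100)
    (s : State n) (hn : s.reg 0 = n) :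
    ExpLE ((walk m).run I s) (fun t => t.reg 0 = n)
      (fun t => if GoodStop α m I.card t.reg then 0 else 1)
      (2 * Real.exp (-(m * α ^ 2 / 4)) * (|(s.reg 10 : ℝ) - κ| + 1)) := by
  have hκn : κ ≤ n + 1 := hκ.le.trans (by simpa using Finset.card_le_univ I)
  set β := 2 * Real.exp (-(m * α ^ 2 / 4)) with hβ
  have hβ0 : 0 ≤ β := by positivity
  set N := s.reg 10 + n + 5 with hN
  -- While the walk runs, the potential is the union bound truncated at `1`, provided the remaining
  -- rounds suffice for a direct walk to `κ`; otherwise it is `1`. An inaccurate measurement is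
  -- counted as a failure.
  set K : ℕ → State n → ℝ := fun i t => if t.reg 12 = 0 then
    (if |(t.reg 10 : ℝ) - κ| + 1 ≤ N - i then min 1 (β * (|(t.reg 10 : ℝ) - κ| + 1)) else 1) else
      (if GoodStop α m I.card t.reg then 0 else 1) with hK
  have K1 : ∀ i t, K i t ≤ 1 := by
    intro i t
    simp only [hK]
    split_ifs <;> simp
  refine ExpLE.assign_seq fun _ => ExpLE.loop N ?_
    (fun _ t => t.reg 0 = n ∧ (t.reg 12 = 0 ∨ t.reg 12 = 1)) K ?_ ?_ ?_ ?_ ?_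
  · simp [Expr.eval, Function.update, hn, hN]
  · intro τ
    simp [Function.update, hn, Expr.eval]
  · intro τ
    have : |(s.reg 10 : ℝ) - κ| + 1 ≤ N := by
      have h1 : (κ : ℝ) ≤ n + 1 := by exact_mod_cast hκn
      rw [hN]
      push_cast
      have := (s.reg 10).cast_nonneg (α := ℝ)
      have := n.cast_nonneg (α := ℝ)
      have := κ.cast_nonneg (α := ℝ)
      linarith [abs_le.2 ⟨(by linarith : -((s.reg 10 : ℝ) + n + 4) ≤ s.reg 10 - κ), by linarith⟩]
    simp [hK, Function.update, Expr.eval, this]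
  · rintro i - t ⟨h0, h12⟩
    rcases h12 with h12 | h12
    · by_cases hx : |(t.reg 10 : ℝ) - κ| + 1 ≤ N - i ∧ β * (|(t.reg 10 : ℝ) - κ| + 1) ≤ 1
      · have hv : K i t = β * |(t.reg 10 : ℝ) - κ| + 1 * β := by
          simp only [hK]
          rw [if_pos h12, if_pos hx.1, min_eq_right hx.2]
          ring
        have hx0 := mul_nonneg hβ0 (abs_nonneg ((t.reg 10 : ℝ) - κ))
        rw [hv, hβ]
        refine expLE_walkStep hκ hα hα1 t h0 h12 (by positivity) zero_le_one ?_ ?_ ?_ ?_ ?_ ?_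
        · exact fun t' _ _ _ => (K1 _ _).trans (by linarith)
        · intro t' g12 ga g10 hlt
          simp only [hK]
          rw [if_pos g12, g10, abs_succ_sub_of_lt hlt, sub_add_cancel, if_pos]
          · exact min_le_right _ _
          · push_cast
            linarith
        · exact fun t' _ _ _ => (K1 _ _).trans (by linarith)
        · intro t' g12 ga g10 hlt
          simp only [hK]
          rw [if_pos g12, g10, abs_pred_sub_of_lt hlt, sub_add_cancel, if_pos]
          · exact min_le_right _ _
          · push_cast
            linarith
        · exact fun t' _ _ _ => (K1 _ _).trans (by linarith)
        · intro t' g12 _ _ g1 g2 g3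
          simp only [hK]
          rw [if_neg (by omega), if_pos ⟨g12, g1, g2, g3⟩]
          exact hx0
      · have hv : K i t = 1 + 0 * β := by
          simp only [hK]
          rw [if_pos h12]
          split_ifs with h
          · rw [min_eq_left (not_le.1 fun h' => hx ⟨h, h'⟩).le]
            ring
          · ring
        rw [hv, hβ]
        exact expLE_walkStep hκ hα hα1 t h0 h12 zero_le_one le_rfl
          (fun t' _ _ _ => (K1 _ _).trans (by linarith)) (fun t' _ _ _ _ => K1 _ _)
          (fun t' _ _ _ => (K1 _ _).trans (by linarith)) (fun t' _ _ _ _ => K1 _ _)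
          (fun t' _ _ _ => (K1 _ _).trans (by linarith)) (fun t' _ _ _ _ _ _ => K1 _ _)
    · refine ExpLE.ite (fun _ _ => ExpLE.assign fun _ => ?_) (fun _ h => ?_)
      · simp [Function.update, h0, h12, hK, GoodStop]
      · simp [Expr.eval, h12] at h
  · exact fun t h => h.1
  · rintro t ⟨-, h12⟩
    simp only [hK]
    rcases h12 with h12 | h12
    · rw [if_pos h12, if_neg (fun h => zero_ne_one (h12.symm.trans h.1)), if_neg]
      have := abs_nonneg ((t.reg 10 : ℝ) - κ)
      linarith
    · rw [if_neg (show ¬ t.reg 12 = 0 by omega)]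

end GroupTesting

/-! ### Computing the estimate from the measurement -/

namespace GroupTesting

def computeStep : Prog :=
  .ite (.reg 14) (.reg 15) skip (.seq (.assign 16 (.add (.reg 16) (.const 1)))
    (.seq (.assign 14 (.mul (.reg 14) (.mul (.reg 9) (.reg 9))))
      (.assign 15 (.mul (.reg 15) (.mul (.reg 13) (.reg 13))))))

def doubleStep : Prog := .assign 13 (.mul (.reg 13) (.const 2))

/-- From the parameter `k` in register `10` and the number `Z` of negative answers in register `11`,
compute the least `D` with `(1 - 2⁻ᵏ) ^ (D + 1 / 2) ≤ Z / m`, or `n` if that is smaller, and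
output it. -/
def compute (m : ℕ) : Prog :=
  .seq (.assign 13 (.const 1)) (.seq (.loop (.reg 10) doubleStep)
    (.seq (.assign 9 (.sub (.reg 13) (.const 1)))
      (.seq (.assign 14 (.mul (.reg 9) (.const (m * m))))
        (.seq (.assign 15 (.mul (.reg 13) (.mul (.reg 11) (.reg 11))))
          (.seq (.assign 16 (.const 0)) (.seq (.loop (.reg 0) computeStep)
            (.assign 0 (.reg 16))))))))

/-- `(1 - 2⁻ᵏ) ^ (2 * D + 1) ≤ (Z / m) ^ 2`, without fractions. -/
def Small (m k Z D : ℕ) : Prop :=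
  (2 ^ k - 1) ^ (2 * D + 1) * (m * m) ≤ (2 ^ k) ^ (2 * D + 1) * (Z * Z)

variable {n : ℕ} {I : Finset (Fin n)} {m d : ℕ} {α : ℝ}

theorem expLE_compute (m : ℕ) (s : State n) (hn : s.reg 0 = n) :
    ExpLE ((compute m).run I s) (fun t => t.asked = s.asked ∧
      (t.reg 0 = n ∨ Small m (s.reg 10) (s.reg 11) (t.reg 0)) ∧
      (t.reg 0 = 0 ∨ ¬ Small m (s.reg 10) (s.reg 11) (t.reg 0 - 1))) (fun _ => 0) 0 := by
  set k := s.reg 10 with hk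
  set Z := s.reg 11 with hZ
  refine ExpLE.assign_seq fun _ => ?_
  refine ExpLE.seq (Q := fun t => t.asked = s.asked ∧ t.reg 0 = n ∧ t.reg 11 = Z ∧
    t.reg 13 = 2 ^ k) (F := fun _ => 0) (ExpLE.loop k (by simp [Expr.eval, hk])
      (fun i t => t.asked = s.asked ∧ t.reg 0 = n ∧ t.reg 11 = Z ∧ t.reg 13 = 2 ^ i)
      (fun _ _ => 0) ?_ ?_ ?_ ?_ ?_) ?_
  · intro τ
    simp [Expr.eval, hn, hZ]
  · exact fun _ => le_rfl
  · rintro i - t ⟨ha, h0, h11, h13⟩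
    refine ExpLE.assign fun _ => ⟨?_, le_rfl⟩
    simp [Expr.eval, ha, h0, h11, h13, pow_succ]
  · exact fun _ h => h
  · exact fun _ _ => le_rfl
  rintro t ⟨ha, h0, h11, h13⟩
  refine ExpLE.assign_seq fun _ => ExpLE.assign_seq fun _ => ExpLE.assign_seq fun _ =>
    ExpLE.assign_seq fun _ => ?_
  refine ExpLE.seq (Q := fun t => t.asked = s.asked ∧ (t.reg 16 = n ∨ Small m k Z (t.reg 16)) ∧
      (t.reg 16 = 0 ∨ ¬ Small m k Z (t.reg 16 - 1))) (F := fun _ => 0) (ExpLE.loop n ?_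
      (fun i t => t.asked = s.asked ∧ t.reg 13 = 2 ^ k ∧ t.reg 9 = 2 ^ k - 1 ∧
        t.reg 14 = (2 ^ k - 1) ^ (2 * t.reg 16 + 1) * (m * m) ∧
        t.reg 15 = (2 ^ k) ^ (2 * t.reg 16 + 1) * (Z * Z) ∧
        (t.reg 16 = i ∨ Small m k Z (t.reg 16)) ∧
        (t.reg 16 = 0 ∨ ¬ Small m k Z (t.reg 16 - 1)))
      (fun _ _ => 0) ?_ ?_ ?_ ?_ ?_) ?_
  · simp [Expr.eval, h0]
  · intro τ
    simp [Expr.eval, ha, h13, h11]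
  · exact fun _ => le_rfl
  · rintro i - t ⟨ha, h13, h9, h14, h15, hi, hd⟩
    refine ExpLE.ite (fun _ h => ExpLE.assign fun _ => ⟨?_, le_rfl⟩)
      (fun _ h => ExpLE.assign_seq fun _ => ExpLE.assign_seq fun _ => ExpLE.assign fun _ =>
        ⟨?_, le_rfl⟩)
    · have hs : Small m k Z (t.reg 16) := by
        simp only [Expr.eval, h14, h15] at h
        exact h
      simpa [Expr.eval, ha, h13, h9, h14, h15, hs] using hd
    · have hs : ¬ Small m k Z (t.reg 16) := by
        simp only [Expr.eval, h14, h15] at h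
        exact h
      have hi' : t.reg 16 = i := hi.resolve_right hs
      rw [hi'] at hs h14 h15
      simp [Expr.eval, Function.update, ha, h13, h9, h14, h15, hs, hi']
      constructor <;> ring
  · exact fun t h => ⟨h.1, h.2.2.2.2.2⟩
  · exact fun _ _ => le_rfl
  rintro t ⟨ha, h⟩
  refine ExpLE.assign fun _ => ⟨?_, le_rfl⟩
  simpa [Expr.eval, ha] using h

theorem small_iff {k Z D : ℕ} (hm : 0 < m) :
    Small m k Z D ↔ (1 - (1 / 2 : ℝ) ^ k) ^ (2 * D + 1) ≤ ((Z : ℝ) / m) ^ 2 := by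
  have hm' : (0 : ℝ) < m := by exact_mod_cast hm
  have h2 : (0 : ℝ) < 2 ^ k := by positivity
  have e : (1 - (1 / 2 : ℝ) ^ k) = (2 ^ k - 1) / 2 ^ k := by
    rw [one_div, inv_pow, sub_div, div_self h2.ne', one_div]
  rw [e, div_pow, div_pow, div_le_div_iff₀ (by positivity) (by positivity), Small,
    ← Nat.cast_le (α := ℝ)]
  push_cast [Nat.one_le_two_pow]
  rw [mul_comm ((2 ^ k : ℝ) ^ (2 * D + 1)), sq, sq]

/-- The measured fraction `x` is within `ε / 512` of `z = q ^ d`, and `z` stays away from `0` and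
`1`. A relative error of `ε` in the exponent `d` would change `z²` by a factor that differs from `1`
by at least `ε / 16`, more than this accuracy permits. -/
theorem estimate_of_goodStop {ε : ℝ} (hε : 0 < ε) (hε1 : ε < 1) (hm : 0 < m) (hd : 1 ≤ d)
    {r : ℕ → ℕ} (h : GoodStop (ε / 512) m d r) {D : ℕ} (hdn : d ≤ n)
    (h1 : D = n ∨ Small m (r 10) (r 11) D) (h2 : D = 0 ∨ ¬ Small m (r 10) (r 11) (D - 1)) :
    (1 - ε) * d ≤ D ∧ (D : ℝ) ≤ (1 + ε) * d := by
  obtain ⟨-, hacc, hlo, hhi⟩ := h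
  set k := r 10
  set Z := r 11
  have hm' : (0 : ℝ) < m := by exact_mod_cast hm
  have hd' : (1 : ℝ) ≤ d := by exact_mod_cast hd
  set x : ℝ := (Z : ℝ) / m with hx
  set z := missProb d k with hz
  set a := ε / 512 with ha
  have hxz : |x - z| ≤ a := by
    have : x - z = ((Z : ℝ) - m * z) / m := by
      rw [hx]
      field_simp
    rw [this, abs_div, abs_of_pos hm', div_le_iff₀ hm']
    exact hacc
  have hx1 : 1 / 8 ≤ x := by
    rw [hx, le_div_iff₀ hm']
    have : (m : ℝ) ≤ 8 * Z := by exact_mod_cast hlo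
    linarith
  have hx2 : x ≤ 3 / 4 := by
    rw [hx, div_le_iff₀ hm']
    have : (4 * Z : ℝ) ≤ 3 * m := by exact_mod_cast hhi
    linarith
  obtain ⟨hx3, hx4⟩ := abs_le.1 hxz
  have hz1 : 1 / 16 ≤ z := by linarith
  have hz2 : z ≤ 7 / 8 := by linarith
  have hz0 : 0 < z := by linarith
  have hk : 1 ≤ k := by
    by_contra hk
    rw [hz, show k = 0 by omega, missProb_zero hd] at hz0
    exact lt_irrefl _ hz0
  set q : ℝ := 1 - (1 / 2) ^ k with hq
  have hk2 : (1 / 2 : ℝ) ^ k ≤ 1 / 2 := by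
    simpa using pow_le_pow_of_le_one (by norm_num : (0 : ℝ) ≤ 1 / 2) (by norm_num) hk
  have hq0 : 0 < q := by linarith
  have hq1 : q ≤ 1 := by linarith [half_pow_nonneg k]
  have hzq : z = q ^ d := rfl
  have hlog : Real.log z ≤ -(1 / 8) := by
    linarith [Real.log_le_sub_one_of_pos hz0]
  have hpow : ∀ y : ℝ, q ^ (y * d) = Real.exp (y * Real.log z) := by
    intro y
    rw [hzq, Real.log_pow, Real.rpow_def_of_pos hq0]
    congr 1
    ring
  have hsq : z ^ 2 = Real.exp (2 * Real.log z) := by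
    rw [two_mul, Real.exp_add, Real.exp_log hz0, sq]
  constructor
  · rcases h1 with h1 | h1
    · have : (d : ℝ) ≤ D := by
        rw [h1]
        exact_mod_cast hdn
      nlinarith
    by_contra hlt
    rw [not_le] at hlt
    rw [small_iff hm, ← hx, ← hq, ← Real.rpow_natCast] at h1
    have hDd : D + 1 ≤ d := by
      have : (D : ℝ) < d := hlt.trans_le (by nlinarith)
      exact_mod_cast this
    have hDd' : (D : ℝ) + 1 ≤ d := by exact_mod_cast hDd
    -- Rounding to the nearest integer pays off here: `2D + 1` is the sum of `D < (1 - ε) d` and `D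
    -- + 1 ≤ d`, so integrality loses nothing even for small `d`. The upper bound uses `2(D - 1) + 1
    -- = D + (D - 1)` likewise.
    have e1 : q ^ ((2 - ε) * d) ≤ q ^ ((2 * D + 1 : ℕ) : ℝ) := by
      apply Real.rpow_le_rpow_of_exponent_ge hq0 hq1
      push_cast
      linarith
    rw [hpow, show (2 - ε) * Real.log z = 2 * Real.log z + -(ε * Real.log z) by ring,
      Real.exp_add, ← hsq] at e1
    have e2 : 1 + ε / 8 ≤ Real.exp (-(ε * Real.log z)) := by
      have := mul_le_mul_of_nonneg_left hlog hε.le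
      linarith [Real.add_one_le_exp (-(ε * Real.log z))]
    have e3 : z ^ 2 * (1 + ε / 8) ≤ x ^ 2 :=
      (mul_le_mul_of_nonneg_left e2 (sq_nonneg z)).trans (e1.trans h1)
    have e4 : x ^ 2 ≤ (z + a) ^ 2 := pow_le_pow_left₀ (by linarith) (by linarith) 2
    rw [ha] at e4
    have e5 := mul_le_mul_of_nonneg_left hz1 (mul_pos hε hz0).le
    have e6 := mul_le_mul_of_nonneg_left hz1 hε.le
    have e7 := mul_le_mul_of_nonneg_left hε1.le hε.le
    linarith
  · rcases h2 with h2 | h2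
    · rw [h2, Nat.cast_zero]
      positivity
    rcases Nat.eq_zero_or_pos D with hD0 | hD0
    · rw [hD0, Nat.cast_zero]
      positivity
    by_contra hlt
    rw [not_le] at hlt
    rw [small_iff hm, ← hx, ← hq, ← Real.rpow_natCast, not_le] at h2
    have hDd : d + 1 ≤ D := by
      have : (d : ℝ) < D := lt_of_le_of_lt (by nlinarith) hlt
      exact_mod_cast this
    have hDd' : (d : ℝ) + 1 ≤ D := by exact_mod_cast hDd
    have e1 : q ^ ((2 * (D - 1) + 1 : ℕ) : ℝ) ≤ q ^ ((2 + ε) * d) := by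
      apply Real.rpow_le_rpow_of_exponent_ge hq0 hq1
      push_cast [hD0]
      linarith
    rw [hpow, show (2 + ε) * Real.log z = 2 * Real.log z + ε * Real.log z by ring,
      Real.exp_add, ← hsq] at e1
    have e2 : Real.exp (ε * Real.log z) ≤ 1 - ε / 16 := by
      have h3 : Real.exp (ε * Real.log z) ≤ Real.exp (-(ε / 8)) :=
        Real.exp_le_exp.2 (by linarith [mul_le_mul_of_nonneg_left hlog hε.le])
      have h4 : Real.exp (-(ε / 8)) ≤ (1 + ε / 8)⁻¹ := by
        rw [Real.exp_neg]
        exact inv_anti₀ (by positivity) (by linarith [Real.add_one_le_exp (ε / 8)])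
      refine h3.trans (h4.trans ?_)
      rw [inv_le_iff_one_le_mul₀ (by positivity)]
      nlinarith
    have e3 : x ^ 2 < z ^ 2 * (1 - ε / 16) :=
      h2.trans_le (e1.trans (mul_le_mul_of_nonneg_left e2 (sq_nonneg z)))
    have e4 : (z - a) ^ 2 ≤ x ^ 2 := pow_le_pow_left₀ (by linarith) (by linarith) 2
    -- The constant `512` is tight here: `z² ε / 16 ≥ z ε / 256 = 2 z a`, because `z ≥ 1 / 16`.
    rw [ha] at e4
    have e5 := mul_le_mul_of_nonneg_left hz1 (mul_pos hε hz0).le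
    linarith [sq_nonneg ε]

end GroupTesting

/-! ### The complete algorithm: tests and error probability -/

namespace GroupTesting

/-- The algorithm that always runs: check that there is a defective item, find a parameter, correct
it, and estimate. -/
def core (m : ℕ) : Prog :=
  .seq (.assign 10 (.const 0)) (.seq randomTest (.ite (.const 1) (.reg 1)
    (.seq search (.seq (walk m) (compute m))) (.assign 0 (.const 0))))

/-- Run `p` with probability `a / 2 ^ l`, and output `0` otherwise. -/
def biased (p : Prog) : ℕ → ℕ → Prog
  | 0, a => if 1 ≤ a then p else .assign 0 (.const 0)
  | l + 1, a => .seq (.coin 4)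
      (.ite (.const 1) (.reg 4) (biased p l (a - 2 ^ l)) (biased p l (min a (2 ^ l))))

variable {n : ℕ} {I : Finset (Fin n)} {m : ℕ}

theorem expLE_core_of_empty (hI : I.card = 0) (m : ℕ) (s : State n) (hn : s.reg 0 = n) :
    ExpLE ((core m).run I s) (fun t => t.reg 0 = 0 ∧ t.asked = s.asked + 1) (fun _ => 0) 0 := by
  refine ExpLE.assign_seq fun _ => ?_
  refine ExpLE.mono (ExpLE.seq (expLE_randomTest _ ?_ (A := 0) (B := 0) le_rfl le_rfl) ?_)
    (fun _ h => h) (fun _ _ => le_rfl) (by simp)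
  · simpa using hn
  · rintro t ⟨-, ha, h⟩
    have h1 : t.reg 1 = 0 := h.resolve_right fun h' => by
      rw [Finset.card_eq_zero] at hI
      simp [hI] at h'
    refine ExpLE.ite (fun _ h => ?_) fun _ _ => ExpLE.assign fun _ => ⟨⟨?_, ha⟩, ?_⟩
    · simp [Expr.eval, h1] at h
    · simp [Expr.eval]
    · simp

theorem expLE_core_asked {κ t₁ : ℕ} {α : ℝ} (hκ : IsThreshold I.card κ)
    (ht₁ : ∀ t, t₁ ≤ t → 1 - missProb I.card (2 ^ t ^ 2) ≤ 1 / 4) (hI : 1 ≤ I.card)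
    (hα : 0 < α) (hα1 : α ≤ 1 / 100)
    (hm : 2 * Real.exp (-(m * α ^ 2 / 4)) ≤ 1 / 4) (s : State n) (hn : s.reg 0 = n)
    (ha : s.asked = 0) :
    ExpLE ((core m).run I s) (fun _ => True) (fun t => t.asked)
      (1 + searchCost t₁ 0 + 52 * m) := by
  have hc : 0 ≤ searchCost t₁ 0 := le_trans (by positivity) (sq_le_searchCost t₁ 0)
  have hm0 : (0 : ℝ) ≤ m := m.cast_nonneg
  refine ExpLE.assign_seq fun _ => ?_
  refine ExpLE.mono (ExpLE.seq (expLE_randomTest _ ?_ (A := 1)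
    (B := 1 + searchCost t₁ 0 + 52 * m) zero_le_one (by positivity)) ?_)
    (fun _ h => h) (fun _ _ => le_rfl) ?_
  · simpa using hn
  · rintro t ⟨f, ga, h⟩
    have f0 : t.reg 0 = n := by simpa [hn] using f 0 (by norm_num)
    replace ga : t.asked = 1 := by simpa [ha] using ga
    refine ExpLE.ite (fun τ hb => ?_) fun _ hb => ExpLE.assign fun _ => ⟨trivial, ?_⟩
    · have h1 : t.reg 1 = 1 := by simp [Expr.eval] at hb; omega
      rw [h1, if_neg one_ne_zero]
      -- Displacement is priced at `2m`, its cost in the walk. The search leaves at most `25` in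
      -- expectation, so the walk costs `2m · 25 + 2m = 52m`. The first test, with parameter `0`,
      -- queries all items and is surely positive here.
      refine ExpLE.seq (((expLE_search hκ ht₁ zero_le_one (by positivity : 0 ≤ 2 * (m : ℝ))
        ⟨t.reg, t.query, t.asked, τ⟩ f0).add_const (by positivity)
        (by positivity : 0 ≤ 2 * (m : ℝ))).mono (fun _ h => h) (fun _ _ => le_rfl) ?_)
        fun t' h0 => ExpLE.seq ((expLE_walk_asked hκ hα hα1 hm t' h0).mono (fun _ h => h)
          (fun _ _ => le_rfl) (by linarith)) fun t'' h0' => ?_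
      · simp only [ga]
        push_cast
        linarith
      · exact ExpLE.of_support fun a ha => ⟨trivial, by
          rw [((expLE_compute m t'' h0').1 a ha).1]⟩
    · have h1 : t.reg 1 = 0 := by simp [Expr.eval] at hb; omega
      simp [h1, ga]
  · simp [Expr.eval, missProb_zero hI]

open Classical in
theorem expLE_core_fail {κ t₁ : ℕ} {ε : ℝ} (hκ : IsThreshold I.card κ)
    (ht₁ : ∀ t, t₁ ≤ t → 1 - missProb I.card (2 ^ t ^ 2) ≤ 1 / 4) (hI : 1 ≤ I.card)
    (hε : 0 < ε) (hε1 : ε < 1) (hm : 0 < m) (s : State n) (hn : s.reg 0 = n) :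
    ExpLE ((core m).run I s) (fun _ => True)
      (fun t => if (1 - ε) * (I.card : ℝ) ≤ t.reg 0 ∧ (t.reg 0 : ℝ) ≤ (1 + ε) * I.card then 0 else 1)
      (26 * (2 * Real.exp (-(m * (ε / 512) ^ 2 / 4)))) := by
  set β := 2 * Real.exp (-(m * (ε / 512) ^ 2 / 4)) with hβ
  have hβ0 : 0 ≤ β := by positivity
  refine ExpLE.assign_seq fun _ => ?_
  refine ExpLE.mono (ExpLE.seq (expLE_randomTest _ ?_ (A := 1)
    (B := 26 * β) zero_le_one (by positivity)) ?_)
    (fun _ h => h) (fun _ _ => le_rfl) ?_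
  · simpa using hn
  · rintro t ⟨f, ga, h⟩
    have f0 : t.reg 0 = n := by simpa [hn] using f 0 (by norm_num)
    refine ExpLE.ite (fun τ hb => ?_) fun _ hb => ExpLE.assign fun _ => ⟨trivial, ?_⟩
    · have h1 : t.reg 1 = 1 := by simp [Expr.eval] at hb; omega
      rw [h1, if_neg one_ne_zero]
      -- Tests now have weight `0` and displacement has weight `β`, its price in the failure bound
      -- of the walk; this gives `25 β + β`.
      refine ExpLE.seq (((expLE_search hκ ht₁ le_rfl hβ0
        ⟨t.reg, t.query, t.asked, τ⟩ f0).add_const (by rw [zero_mul, zero_add]; positivity) hβ0).mono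
        (fun _ h => h) (fun _ _ => le_rfl) (by linarith))
        fun t' h0 => ExpLE.seq ((expLE_walk_fail (α := ε / 512) hκ (by positivity) (by linarith) t' h0).mono
          (fun _ h => h) (fun _ _ => le_rfl) (by rw [← hβ]; linarith)) fun t'' h0' => ?_
      refine ExpLE.of_support fun a ha => ⟨trivial, ?_⟩
      obtain ⟨-, g1, g2⟩ := (expLE_compute m t'' h0').1 a ha
      by_cases hgood : GoodStop (ε / 512) m I.card t''.reg
      · rw [if_pos hgood, if_pos (estimate_of_goodStop hε hε1 hm hI hgood
          (by simpa using Finset.card_le_univ I) g1 g2)]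
      · rw [if_neg hgood]
        split_ifs <;> simp
    · have h1 : t.reg 1 = 0 := by simp [Expr.eval] at hb; omega
      rw [h1, if_pos rfl]
      split_ifs <;> simp
  · simp [Expr.eval, missProb_zero hI]

theorem loglog_nonneg (d : ℕ) : 0 ≤ loglog d := by
  have h2 : (2 : ℝ) ≤ (max d 2 : ℕ) := by exact_mod_cast le_max_right d 2
  refine Real.logb_nonneg (by norm_num) ?_
  rw [Real.le_logb_iff_rpow_le (by norm_num) (by linarith), Real.rpow_one]
  exact h2

/-- Let `T` be the least `t` with `4d ≤ 2 ^ 2 ^ t ^ 2`; Bernoulli's inequality then gives the bound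
`1 / 4`. Minimality and two logarithms yield `(T - 1)² ≤ loglog d + 2`, and the cost is `T² + 2T + 2
= (T - 1)² + 4(T - 1) + 5`. -/
theorem exists_searchCost_le {d : ℕ} (hd : 1 ≤ d) :
    ∃ t₁, (∀ t, t₁ ≤ t → 1 - missProb d (2 ^ t ^ 2) ≤ 1 / 4) ∧
      searchCost t₁ 0 ≤ loglog d + 4 * √(loglog d) + 13 := by
  classical
  have hex : ∃ t : ℕ, 4 * d ≤ 2 ^ 2 ^ t ^ 2 := by
    refine ⟨d + 1, ?_⟩
    have h1 : d + 2 ≤ 2 ^ (d + 1) := Nat.lt_two_pow_self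
    have h2 : 2 ^ (d + 1) ≤ 2 ^ (d + 1) ^ 2 :=
      Nat.pow_le_pow_right two_pos (Nat.le_self_pow two_ne_zero _)
    have h3 : d ≤ 2 ^ d := Nat.lt_two_pow_self.le
    have h4 : 2 ^ (d + 2) ≤ 2 ^ 2 ^ (d + 1) ^ 2 := Nat.pow_le_pow_right two_pos (h1.trans h2)
    rw [pow_add] at h4
    omega
  refine ⟨Nat.find hex, fun t ht => ?_, ?_⟩
  · have h1 : 4 * d ≤ 2 ^ 2 ^ t ^ 2 := (Nat.find_spec hex).trans
      (Nat.pow_le_pow_right two_pos (Nat.pow_le_pow_right two_pos (Nat.pow_le_pow_left ht 2)))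
    refine (one_sub_missProb_le d _).trans ?_
    have h2 : (4 * d : ℝ) ≤ 2 ^ 2 ^ t ^ 2 := by exact_mod_cast h1
    rw [one_div, inv_pow, ← div_eq_mul_inv, div_le_iff₀ (by positivity)]
    linarith
  · set T := Nat.find hex with hT
    set lam := loglog d with hlam
    have hl0 : 0 ≤ lam := loglog_nonneg d
    have hs0 := Real.sqrt_nonneg lam
    have hs := Real.sq_sqrt hl0
    rw [searchCost, if_pos (Nat.zero_le _)]
    rcases Nat.eq_zero_or_pos T with h0 | h0
    · rw [h0]
      norm_num
      linarith
    · have h1 := Nat.find_min hex (show T - 1 < Nat.find hex by omega)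
      rw [not_le] at h1
      have hd2 : (2 : ℝ) ≤ (max d 2 : ℕ) := by exact_mod_cast le_max_right d 2
      set l := Real.logb 2 (max d 2 : ℕ) with hl
      have hl1 : 1 ≤ l := by
        rw [hl, Real.le_logb_iff_rpow_le (by norm_num) (by linarith), Real.rpow_one]
        exact hd2
      have h2 : (2 : ℝ) ^ (2 ^ (T - 1) ^ 2) ≤ 4 * (max d 2 : ℕ) := by
        have : 2 ^ 2 ^ (T - 1) ^ 2 ≤ 4 * max d 2 := h1.le.trans
          (Nat.mul_le_mul_left 4 (le_max_left _ _))
        exact_mod_cast this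
      have h3 : ((2 ^ (T - 1) ^ 2 : ℕ) : ℝ) ≤ 2 + l := by
        have := Real.logb_le_logb_of_le (b := 2) (by norm_num) (by positivity) h2
        rw [Real.logb_pow, Real.logb_self_eq_one (by norm_num), mul_one,
          Real.logb_mul (by norm_num) (by positivity), show (4 : ℝ) = 2 ^ (2 : ℕ) by norm_num,
          Real.logb_pow, Real.logb_self_eq_one (by norm_num), ← hl] at this
        push_cast at this ⊢
        linarith
      have h4 : (((T - 1) ^ 2 : ℕ) : ℝ) ≤ 2 + lam := by
        have h5 : (2 : ℝ) ^ ((T - 1) ^ 2) ≤ 4 * l := by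
          push_cast at h3
          linarith
        have := Real.logb_le_logb_of_le (b := 2) (by norm_num) (by positivity) h5
        rw [Real.logb_pow, Real.logb_self_eq_one (by norm_num), mul_one,
          Real.logb_mul (by norm_num) (by positivity), show (4 : ℝ) = 2 ^ (2 : ℕ) by norm_num,
          Real.logb_pow, Real.logb_self_eq_one (by norm_num)] at this
        rw [hlam, loglog, ← hl]
        push_cast at this
        rw [Nat.cast_pow]
        linarith
      push_cast [h0] at h4
      have h6 : (T : ℝ) - 1 ≤ √lam + 3 / 2 := by
        refine abs_le_of_sq_le_sq' (h4.trans ?_) (by positivity) |>.2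
        nlinarith
      push_cast
      nlinarith

theorem exists_core_spec {ε δ : ℝ} (hε : 0 < ε) (hε1 : ε < 1) (hδ : 0 < δ) (hδ1 : δ ≤ 1 / 3) :
    ∃ m : ℕ, ∀ (n : ℕ) (I : Finset (Fin n)) (s : State n), s.reg 0 = n → s.asked = 0 →
      ExpLE ((core m).run I s) (fun _ => True)
        (fun t => open Classical in if (1 - ε) * (I.card : ℝ) ≤ t.reg 0 ∧
          (t.reg 0 : ℝ) ≤ (1 + ε) * I.card then 0 else 1) δ ∧
      ExpLE ((core m).run I s) (fun _ => True) (fun t => t.asked)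
        (loglog I.card + 4 * √(loglog I.card) + 3 * 10 ^ 8 * (1 / ε ^ 2 * Real.logb 2 (1 / δ))) := by
  set L := Real.logb 2 (1 / δ) with hL
  have hlog2 := Real.log_two_lt_d9
  have hlog2' : 0 < Real.log 2 := Real.log_pos one_lt_two
  have hlogδ : Real.log (1 / δ) = L * Real.log 2 := by
    rw [hL, Real.logb, div_mul_cancel₀ _ hlog2'.ne']
  have hL1 : 1 ≤ L := by
    rw [hL, Real.le_logb_iff_rpow_le (by norm_num) (by positivity), Real.rpow_one,
      le_div_iff₀ hδ]
    linarith
  have h52 : Real.log 52 ≤ 4.2 := by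
    have : Real.log 52 ≤ Real.log (2 ^ 6) := Real.log_le_log (by norm_num) (by norm_num)
    rw [Real.log_pow] at this
    push_cast at this
    linarith
  -- Solves `26 · 2 exp (-x (ε / 512)² / 4) = δ`. The assumption `δ ≤ 1 / 3` gives `L ≥ 1`, so
  -- additive constants are absorbed into the last term.
  set x : ℝ := 4 * 512 ^ 2 / ε ^ 2 * Real.log (52 / δ) with hx
  have hlog : Real.log (52 / δ) ≤ 5 * L := by
    rw [show 52 / δ = 52 * (1 / δ) by ring, Real.log_mul (by norm_num) (by positivity), hlogδ]
    nlinarith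
  have hlog0 : 0 < Real.log (52 / δ) :=
    Real.log_pos (by rw [lt_div_iff₀ hδ]; linarith)
  have hx0 : 0 < x := by positivity
  have hm0 : 0 < ⌈x⌉₊ := Nat.ceil_pos.2 hx0
  have hε2 : 1 ≤ 1 / ε ^ 2 := by
    rw [le_div_iff₀ (by positivity)]
    nlinarith
  have hmx : (⌈x⌉₊ : ℝ) ≤ 5242881 * (1 / ε ^ 2 * L) := by
    have h1 := (Nat.ceil_lt_add_one hx0.le).le
    have h2 : x ≤ 5242880 * (1 / ε ^ 2 * L) := by
      rw [hx]
      calc _ ≤ 4 * 512 ^ 2 / ε ^ 2 * (5 * L) := by gcongr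
        _ = _ := by ring
    nlinarith
  have hβ : 2 * Real.exp (-(⌈x⌉₊ * (ε / 512) ^ 2 / 4)) ≤ δ / 26 := by
    have h1 : Real.log (52 / δ) ≤ ⌈x⌉₊ * (ε / 512) ^ 2 / 4 := by
      calc Real.log (52 / δ) = x * (ε / 512) ^ 2 / 4 := by rw [hx]; field_simp
        _ ≤ _ := by gcongr; exact Nat.le_ceil x
    have h2 : Real.exp (-(⌈x⌉₊ * (ε / 512) ^ 2 / 4)) ≤ (52 / δ)⁻¹ := by
      rw [← Real.exp_log (by positivity : 0 < (52 / δ)⁻¹), Real.log_inv]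
      exact Real.exp_le_exp.2 (by linarith)
    rw [inv_div] at h2
    linarith
  refine ⟨⌈x⌉₊, fun n I s hn ha => ?_⟩
  have hl := loglog_nonneg I.card
  have hs := Real.sqrt_nonneg (loglog I.card)
  rcases Nat.eq_zero_or_pos I.card with hI | hI
  · have hcore := expLE_core_of_empty hI ⌈x⌉₊ s hn
    refine ⟨ExpLE.of_support fun t ht => ⟨trivial, ?_⟩, ExpLE.of_support fun t ht => ⟨trivial, ?_⟩⟩
    · rw [(hcore.1 t ht).1, hI]
      simpa using hδ.le
    · rw [(hcore.1 t ht).2, ha]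
      push_cast
      nlinarith
  · obtain ⟨κ, hκ⟩ := exists_isThreshold hI
    obtain ⟨t₁, ht₁, hcost⟩ := exists_searchCost_le hI
    refine ⟨(expLE_core_fail hκ ht₁ hI hε hε1 hm0 s hn).mono (fun _ h => h) (fun _ _ => le_rfl)
      (by linarith), (expLE_core_asked hκ ht₁ hI (α := ε / 512) (by positivity) (by linarith)
        (by linarith) s hn ha).mono (fun _ h => h) (fun _ _ => le_rfl) ?_⟩
    nlinarith

theorem expLE_biased {p : Prog} {F : State n → ℝ} {V W : ℝ} (hV : 0 ≤ V) (hW : 0 ≤ W)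
    (hp : ∀ s : State n, s.reg 0 = n → s.asked = 0 → ExpLE (p.run I s) (fun _ => True) F V)
    (hq : ∀ t : State n, t.reg 0 = 0 → t.asked = 0 → F t ≤ W) (l a : ℕ) (hal : a ≤ 2 ^ l)
    (s : State n) (hn : s.reg 0 = n) (ha : s.asked = 0) :
    ExpLE ((biased p l a).run I s) (fun _ => True) F
      ((a / 2 ^ l : ℝ) * V + (1 - (a / 2 ^ l : ℝ)) * W) := by
  induction l generalizing a s with
  | zero =>
    rw [biased]
    split_ifs with h
    · rw [show a = 1 by simp at hal; omega]
      simpa using hp s hn ha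
    · rw [show a = 0 by omega]
      exact ExpLE.assign fun τ => ⟨trivial, by
        simpa [Expr.eval] using hq ⟨Function.update s.reg 0 0, s.query, s.asked, τ⟩ (by simp) ha⟩
  | succ l ih =>
    have mix : ∀ b : ℕ, b ≤ 2 ^ l → 0 ≤ (b / 2 ^ l : ℝ) * V + (1 - (b / 2 ^ l : ℝ)) * W := by
      intro b hb
      have : (b / 2 ^ l : ℝ) ≤ 1 := by
        rw [div_le_one (by positivity)]
        exact_mod_cast hb
      exact add_nonneg (mul_nonneg (by positivity) hV) (mul_nonneg (by linarith) hW)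
    have h1 : a - 2 ^ l ≤ 2 ^ l := by
      rw [pow_succ] at hal
      omega
    have h2 : min a (2 ^ l) ≤ 2 ^ l := min_le_right _ _
    refine ExpLE.seq (Q := fun t => t.reg 0 = n ∧ t.asked = 0)
      (F := fun t => if t.reg 4 = 0 then
        ((min a (2 ^ l) : ℕ) / 2 ^ l : ℝ) * V + (1 - ((min a (2 ^ l) : ℕ) / 2 ^ l : ℝ)) * W
        else ((a - 2 ^ l : ℕ) / 2 ^ l : ℝ) * V + (1 - ((a - 2 ^ l : ℕ) / 2 ^ l : ℝ)) * W) ?_ ?_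
    · rw [Prog.run]
      refine ExpLE.coin (by simp [hn, ha]) (by simp [hn, ha]) ?_ ?_ ?_
      · simpa using mix _ h2
      · simpa using mix _ h1
      -- The coin splits the numerator `a` into two parts of at most `2 ^ l` with sum `a`, so the
      -- average of the two running probabilities is `a / 2 ^ (l + 1)`.
      · have e : ((min a (2 ^ l) : ℕ) : ℝ) + (a - 2 ^ l : ℕ) = a := by
          rw [← Nat.cast_add]
          congr 1
          omega
        simp only [Function.update_self, Fin.val_zero, Fin.val_one, if_true, one_ne_zero, if_false]
        rw [← e, pow_succ]
        apply le_of_eq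
        field_simp
        ring
    · rintro t ⟨g0, ga⟩
      refine ExpLE.ite (fun _ h => ?_) (fun _ h => ?_)
      · simp only [Expr.eval] at h
        rw [if_neg (by omega)]
        exact ih _ h1 _ g0 ga
      · simp only [Expr.eval] at h
        rw [if_pos (by omega)]
        exact ih _ h2 _ g0 ga

end GroupTesting

namespace GroupTesting

/-! ### Running time -/

/-- The number of nodes of an expression. -/
def Expr.nodes : Expr → ℕ
  | .const _ => 1
  | .reg _ => 1
  | .add a b => a.nodes + b.nodes + 1
  | .sub a b => a.nodes + b.nodes + 1
  | .mul a b => a.nodes + b.nodes + 1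
  | .div a b => a.nodes + b.nodes + 1

/-- All constants in an expression are less than `c`. -/
def Expr.ConstsLt (c : ℕ) : Expr → Prop
  | .const k => k < c
  | .reg _ => True
  | .add a b => a.ConstsLt c ∧ b.ConstsLt c
  | .sub a b => a.ConstsLt c ∧ b.ConstsLt c
  | .mul a b => a.ConstsLt c ∧ b.ConstsLt c
  | .div a b => a.ConstsLt c ∧ b.ConstsLt c

/-- All registers hold numbers of at most `b` bits. -/
def Fits (b : ℕ) (r : ℕ → ℕ) : Prop := ∀ x, r x < 2 ^ b

theorem Fits.update {b : ℕ} {r : ℕ → ℕ} (h : Fits b r) (x : ℕ) {v : ℕ} (hv : v < 2 ^ b) :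
    Fits b (Function.update r x v) := fun y => by
  rcases eq_or_ne y x with rfl | hy
  · simpa using hv
  · simpa [hy] using h y

theorem Expr.eval_lt {b : ℕ} (hb : 1 ≤ b) {r : ℕ → ℕ} (hr : Fits b r) (e : Expr)
    (he : e.ConstsLt (2 ^ b)) : e.eval r < 2 ^ (b * e.nodes) := by
  have mono : ∀ {i j : ℕ}, i ≤ j → 2 ^ (b * i) ≤ 2 ^ (b * j) := fun h =>
    Nat.pow_le_pow_right two_pos (Nat.mul_le_mul_left b h)
  induction e with
  | const k => simpa [eval, nodes, ConstsLt] using he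
  | reg x => simpa [eval, nodes] using hr x
  | add e f ihe ihf =>
    have h1 := (ihe he.1).trans_le (mono (show e.nodes ≤ e.nodes + f.nodes by omega))
    have h2 := (ihf he.2).trans_le (mono (show f.nodes ≤ e.nodes + f.nodes by omega))
    have h3 : 2 ^ (b * (e.nodes + f.nodes)) * 2 ≤ 2 ^ (b * (e.nodes + f.nodes + 1)) := by
      rw [mul_add_one b, pow_add]
      exact Nat.mul_le_mul_left _ (Nat.le_self_pow (by omega) 2)
    simp only [eval, nodes]
    omega
  | sub e f ihe _ =>
    have h1 := (ihe he.1).trans_le (mono (show e.nodes ≤ e.nodes + f.nodes + 1 by omega))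
    simp only [eval, nodes]
    omega
  | mul e f ihe ihf =>
    simp only [eval, nodes]
    refine (Nat.mul_lt_mul'' (ihe he.1) (ihf he.2)).trans_le ?_
    rw [← pow_add, ← mul_add]
    exact mono (by omega)
  | div e f ihe _ =>
    have h1 := (ihe he.1).trans_le (mono (show e.nodes ≤ e.nodes + f.nodes + 1 by omega))
    exact (Nat.div_le_self _ _).trans_lt h1

theorem Expr.cost_le_mul {b : ℕ} (hb : 1 ≤ b) {r : ℕ → ℕ} (hr : Fits b r) (e : Expr)
    (he : e.ConstsLt (2 ^ b)) {N : ℕ} (hN : e.nodes ≤ N) : e.cost r ≤ e.nodes * (1 + b * N) := by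
  have h : Nat.size (e.eval r) ≤ b * N := Nat.size_le.2 ((e.eval_lt hb hr he).trans_le
    (Nat.pow_le_pow_right two_pos (Nat.mul_le_mul_left b hN)))
  induction e with
  | const k => simpa [eval, nodes, cost] using h
  | reg x => simpa [eval, nodes, cost] using h
  | add e f ihe ihf | sub e f ihe ihf | mul e f ihe ihf | div e f ihe ihf =>
    simp only [nodes] at hN
    have h1 := ihe he.1 (by omega) (Nat.size_le.2 ((e.eval_lt hb hr he.1).trans_le
      (Nat.pow_le_pow_right two_pos (Nat.mul_le_mul_left b (by omega)))))
    have h2 := ihf he.2 (by omega) (Nat.size_le.2 ((f.eval_lt hb hr he.2).trans_le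
      (Nat.pow_le_pow_right two_pos (Nat.mul_le_mul_left b (by omega)))))
    simp only [eval] at h
    simp only [nodes, cost, add_mul, one_mul] at *
    omega

/-- A bound for the time to evaluate a short expression when the registers hold at most `b` bits. -/
def unitTime (b : ℕ) : ℕ := 100 * (b + 1)

/-- `e` has at most ten nodes, and its constants have at most `b` bits. -/
def Expr.Short (b : ℕ) (e : Expr) : Prop := e.nodes ≤ 10 ∧ e.ConstsLt (2 ^ b)

theorem Expr.Short.cost_le {b : ℕ} (hb : 1 ≤ b) {r : ℕ → ℕ} (hr : Fits b r) {e : Expr}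
    (he : e.Short b) : e.cost r ≤ unitTime b := by
  refine (e.cost_le_mul hb hr he.2 he.1).trans ?_
  rw [unitTime]
  nlinarith [he.1]

/-- Started with registers of at most `b` bits that satisfy `P`, the program `p` takes time at
most `T`, and ends with registers of at most `b` bits that satisfy `Q`. -/
def Takes (n b : ℕ) (p : Prog) (P : (ℕ → ℕ) → Prop) (T : ℕ) (Q : (ℕ → ℕ) → Prop) : Prop :=
  ∀ (I : Finset (Fin n)) (s : State n), Fits b s.reg → P s.reg → ∀ t ∈ (p.run I s).support,
    Fits b t.reg ∧ Q t.reg ∧ t.time ≤ s.time + T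

section Takes

variable {n b : ℕ} {p q : Prog} {P P' Q Q' R : (ℕ → ℕ) → Prop} {T T' U : ℕ}

theorem Takes.mono (h : Takes n b p P T Q) (hP : ∀ r, P' r → P r) (hT : T ≤ T')
    (hQ : ∀ r, Q r → Q' r) : Takes n b p P' T' Q' := fun I s hs hP' t ht =>
  have := h I s hs (hP _ hP') t ht
  ⟨this.1, hQ _ this.2.1, this.2.2.trans (by omega)⟩

theorem Takes.assign (hb : 1 ≤ b) {x : ℕ} {e : Expr} (he : e.Short b)
    (h : ∀ r, Fits b r → P r → e.eval r < 2 ^ b ∧ Q (Function.update r x (e.eval r))) :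
    Takes n b (.assign x e) P (unitTime b) Q := by
  intro I s hs hP t ht
  rw [Prog.run, PMF.support_pure, Set.mem_singleton_iff] at ht
  subst ht
  exact ⟨hs.update x (h _ hs hP).1, (h _ hs hP).2, Nat.add_le_add_left (he.cost_le hb hs) _⟩

theorem Takes.coin (hb : 1 ≤ b) {x : ℕ} (h : ∀ r, P r → ∀ v ≤ 1, Q (Function.update r x v)) :
    Takes n b (.coin x) P (unitTime b) Q := by
  intro I s hs hP t ht
  rw [Prog.run, PMF.support_map] at ht
  obtain ⟨v, -, rfl⟩ := ht
  have : 2 ≤ 2 ^ b := Nat.le_self_pow (by omega) 2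
  exact ⟨hs.update x (by omega), h _ hP _ (by omega), Nat.add_le_add_left (by rw [unitTime]; omega) _⟩

theorem Takes.clear : Takes n b .clear P (unitTime b) P := by
  intro I s hs hP t ht
  rw [Prog.run, PMF.support_pure, Set.mem_singleton_iff] at ht
  subst ht
  exact ⟨hs, hP, Nat.add_le_add_left (by rw [unitTime]; omega) _⟩

theorem Takes.insert (hb : 1 ≤ b) {e : Expr} (he : e.Short b) :
    Takes n b (.insert e) P (unitTime b) P := by
  intro I s hs hP t ht
  rw [Prog.run, PMF.support_pure, Set.mem_singleton_iff] at ht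
  subst ht
  exact ⟨hs, hP, Nat.add_le_add_left (he.cost_le hb hs) _⟩

theorem Takes.ask (hb : 1 ≤ b) {x : ℕ} (h : ∀ r, P r → ∀ v ≤ 1, Q (Function.update r x v)) :
    Takes n b (.ask x) P (unitTime b) Q := by
  intro I s hs hP t ht
  rw [Prog.run, PMF.support_pure, Set.mem_singleton_iff] at ht
  subst ht
  have h2 : 2 ≤ 2 ^ b := Nat.le_self_pow (by omega) 2
  have h1 : answer I s.query ≤ 1 := by
    rw [answer]
    split_ifs <;> simp
  exact ⟨hs.update x (by omega), h _ hP _ h1, Nat.add_le_add_left (by rw [unitTime]; omega) _⟩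

theorem Takes.seq (hp : Takes n b p P T Q) (hq : Takes n b q Q U R) :
    Takes n b (.seq p q) P (T + U) R := by
  intro I s hs hP t ht
  rw [Prog.run, PMF.mem_support_bind_iff] at ht
  obtain ⟨t', ht', ht⟩ := ht
  have h1 := hp I s hs hP t' ht'
  have h2 := hq I t' h1.1 h1.2.1 t ht
  exact ⟨h2.1, h2.2.1, by omega⟩

/-- The times of both branches are added instead of maximized, which keeps the bounds built from
sums and products only. -/
theorem Takes.ite (hb : 1 ≤ b) {e f : Expr} (he : e.Short b) (hf : f.Short b)
    (hp : Takes n b p (fun r => P r ∧ e.eval r ≤ f.eval r) T Q)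
    (hq : Takes n b q (fun r => P r ∧ ¬ e.eval r ≤ f.eval r) U Q) :
    Takes n b (.ite e f p q) P (2 * unitTime b + T + U) Q := by
  intro I s hs hP t ht
  rw [Prog.run] at ht
  have h1 := he.cost_le hb hs
  have h2 := hf.cost_le hb hs
  split_ifs at ht with h
  · have h3 := hp I ⟨s.reg, s.query, s.asked, s.time + e.cost s.reg + f.cost s.reg⟩ hs ⟨hP, h⟩ t ht
    exact ⟨h3.1, h3.2.1, by have := h3.2.2; dsimp only at this; omega⟩
  · have h3 := hq I ⟨s.reg, s.query, s.asked, s.time + e.cost s.reg + f.cost s.reg⟩ hs ⟨hP, h⟩ t ht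
    exact ⟨h3.1, h3.2.1, by have := h3.2.2; dsimp only at this; omega⟩

theorem Takes.loop (hb : 1 ≤ b) {e : Expr} (he : e.Short b) (N : ℕ) (J : ℕ → (ℕ → ℕ) → Prop)
    (hN : ∀ r, P r → e.eval r ≤ N ∧ J 0 r)
    (hp : ∀ i < N, Takes n b p (J i) T (J (i + 1))) (hQ : ∀ i ≤ N, ∀ r, J i r → Q r) :
    Takes n b (.loop e p) P (unitTime b + N * T) Q := by
  intro I s hs hP t ht
  rw [Prog.run] at ht
  have key : ∀ (c i : ℕ), i + c ≤ N → ∀ s : State n, Fits b s.reg → J i s.reg →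
      ∀ t ∈ (iterate (p.run I) c s).support,
        Fits b t.reg ∧ J (i + c) t.reg ∧ t.time ≤ s.time + c * T := by
    intro c
    induction c with
    | zero =>
      intro i _ s hs hJ t ht
      rw [iterate, PMF.support_pure, Set.mem_singleton_iff] at ht
      subst ht
      exact ⟨hs, hJ, by omega⟩
    | succ c ih =>
      intro i hi s hs hJ t ht
      rw [iterate, PMF.mem_support_bind_iff] at ht
      obtain ⟨t', ht', ht⟩ := ht
      have h1 := hp i (by omega) I s hs hJ t' ht'
      have h2 := ih (i + 1) (by omega) t' h1.1 h1.2.1 t ht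
      refine ⟨h2.1, by simpa [add_assoc, add_comm 1 c] using h2.2.1, ?_⟩
      rw [add_one_mul]
      omega
  have h1 := key (e.eval s.reg) 0 (by simpa using (hN _ hP).1)
    ⟨s.reg, s.query, s.asked, s.time + e.cost s.reg⟩ hs (hN _ hP).2 t ht
  have h2 := he.cost_le hb hs
  have h3 := Nat.mul_le_mul_right T (hN _ hP).1
  exact ⟨h1.1, hQ _ (by simpa using (hN _ hP).1) _ h1.2.1,
    by have := h1.2.2; dsimp only at this; omega⟩

end Takes

/-- `P` does not depend on the scratch registers `1, …, 4`. -/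
def ScratchFree (P : (ℕ → ℕ) → Prop) : Prop :=
  ∀ r x v, 1 ≤ x → x ≤ 4 → P r → P (Function.update r x v)

def testTime (n b M : ℕ) : ℕ :=
  unitTime b + (unitTime b + (unitTime b + n * (unitTime b + (unitTime b + M * (unitTime b + unitTime b)) +
    (2 * unitTime b + unitTime b + unitTime b + unitTime b)) + unitTime b))

variable {n b m M : ℕ} {P : (ℕ → ℕ) → Prop}

theorem takes_tossCoins (hb : 1 ≤ b) (hM : M < 2 ^ b)
    (hP : ∀ r x v, 3 ≤ x → x ≤ 4 → P r → P (Function.update r x v)) (h10 : ∀ r, P r → r 10 ≤ M) :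
    Takes n b tossCoins P (unitTime b + (unitTime b + M * (unitTime b + unitTime b))) P := by
  have h2 : 2 ≤ 2 ^ b := Nat.le_self_pow (by omega) 2
  refine Takes.seq (Q := fun r => P r ∧ r 3 = 0) (Takes.assign hb ⟨by simp [Expr.nodes], by
    simp [Expr.ConstsLt]⟩ fun r _ h => ?_) (Takes.loop hb ⟨by simp [Expr.nodes], by simp [Expr.ConstsLt]⟩ M
    (fun i r => P r ∧ r 3 ≤ i) (fun r h => ⟨h10 r h.1, h.1, h.2.le⟩) (fun i hi => Takes.seq
    (Q := fun r => P r ∧ r 3 ≤ i ∧ r 4 ≤ 1) (Takes.coin hb fun r h v hv => ?_)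
    (Takes.assign hb ⟨by simp [Expr.nodes], by simp [Expr.ConstsLt]⟩ fun r _ h => ?_))
    fun _ _ r h => h.1)
  · exact ⟨by simp [Expr.eval], hP _ _ _ le_rfl (by norm_num) h, by simp [Expr.eval]⟩
  · exact ⟨hP _ _ _ (by norm_num) le_rfl h.1, by simpa using h.2, by simpa using hv⟩
  · refine ⟨?_, hP _ _ _ le_rfl (by norm_num) h.1, ?_⟩
    all_goals
      simp only [Expr.eval, Function.update_self]
      omega

theorem takes_randomTest (hb : 1 ≤ b) (hM : M < 2 ^ b) (hn : n < 2 ^ b) (hP : ScratchFree P)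
    (h0 : ∀ r, P r → r 0 = n) (h10 : ∀ r, P r → r 10 ≤ M) :
    Takes n b randomTest P (testTime n b M) (fun r => P r ∧ r 1 ≤ 1) := by
  have h2 : 2 ≤ 2 ^ b := Nat.le_self_pow (by omega) 2
  refine Takes.seq Takes.clear (Takes.seq (Q := fun r => P r ∧ r 2 = 0) (Takes.assign hb
    ⟨by simp [Expr.nodes], by simp [Expr.ConstsLt]⟩ fun r _ h => ?_) (Takes.seq (Q := P)
    (Takes.loop hb ⟨by simp [Expr.nodes], by simp [Expr.ConstsLt]⟩ n
    (fun i r => P r ∧ r 2 ≤ i) (fun r h => ⟨(h0 r h.1).le, h.1, h.2.le⟩) (fun i hi => Takes.seq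
    (takes_tossCoins hb hM ?_ fun r h => h10 r h.1)
    (Takes.seq (Takes.ite hb ⟨by simp [Expr.nodes], by simp [Expr.ConstsLt]⟩ ⟨by simp [Expr.nodes], by
      simp [Expr.ConstsLt]⟩ ((Takes.insert hb ⟨by simp [Expr.nodes], by simp [Expr.ConstsLt]⟩).mono
        (fun _ h => h.1) le_rfl (fun _ h => h)) (Takes.assign hb
    ⟨by simp [Expr.nodes], by simp [Expr.ConstsLt]⟩ fun r _ h => ?_)) (Takes.assign hb
    ⟨by simp [Expr.nodes], by simp [Expr.ConstsLt]; omega⟩ fun r _ h => ?_))) fun _ _ r h => h.1)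
    (Takes.ask hb fun r h v hv => ?_)))
  · exact ⟨by simp [Expr.eval], hP _ _ _ (by norm_num) (by norm_num) h, by simp [Expr.eval]⟩
  · intro r x v hx hx' h
    exact ⟨hP _ _ _ (by omega) hx' h.1, by rw [Function.update_of_ne (by omega)]; exact h.2⟩
  · exact ⟨by simp [Expr.eval], hP _ _ _ (by norm_num) (by norm_num) h.1.1, by simpa using h.1.2⟩
  · refine ⟨?_, hP _ _ _ (by norm_num) (by norm_num) h.1, ?_⟩
    all_goals
      simp only [Expr.eval, Function.update_self]
      omega
  · exact ⟨hP _ _ _ (by norm_num) (by norm_num) h, by simpa using hv⟩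

def measureTime (m n b M : ℕ) : ℕ :=
  unitTime b + (unitTime b + m * (testTime n b M + unitTime b))

theorem takes_measure (hb : 1 ≤ b) (hM : M < 2 ^ b) (hn : n < 2 ^ b) (hm : m < 2 ^ b)
    (hP : ScratchFree P) (hP' : ∀ r v, P r → P (Function.update r 11 v))
    (h0 : ∀ r, P r → r 0 = n) (h10 : ∀ r, P r → r 10 ≤ M) :
    Takes n b (measure m) P (measureTime m n b M) (fun r => P r ∧ r 11 ≤ m) := by
  have h2 : 2 ≤ 2 ^ b := Nat.le_self_pow (by omega) 2
  refine Takes.seq (Q := fun r => P r ∧ r 11 = 0) (Takes.assign hb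
    ⟨by simp [Expr.nodes], by simp [Expr.ConstsLt]⟩ fun r _ h => ?_)
    (Takes.loop hb ⟨by simp [Expr.nodes], by simpa [Expr.ConstsLt] using hm⟩ m (fun i r => P r ∧ r 11 ≤ i)
    (fun r h => ⟨le_rfl, h.1, h.2.le⟩) (fun i hi => Takes.seq
    (takes_randomTest hb hM hn ?_ (fun r h => h0 r h.1) fun r h => h10 r h.1) (Takes.assign hb
    ⟨by simp [Expr.nodes], by simp [Expr.ConstsLt]; omega⟩ fun r _ h => ?_))
    fun i hi r h => ⟨h.1, h.2.trans hi⟩)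
  · exact ⟨by simp [Expr.eval], hP' _ _ h, by simp [Expr.eval]⟩
  · intro r x v hx hx' h
    exact ⟨hP _ _ _ hx hx' h.1, by rw [Function.update_of_ne (by omega)]; exact h.2⟩
  · refine ⟨?_, hP' _ _ h.1.1, ?_⟩
    all_goals
      simp only [Expr.eval, Function.update_self]
      omega

end GroupTesting

/-! ### Register sizes and running time of the phases -/

namespace GroupTesting

variable {n b m K M : ℕ} {P Q : (ℕ → ℕ) → Prop}

theorem Expr.Short.of_le (hb : 4 ≤ b) {e : Expr} (h : e.nodes ≤ 10) (h' : e.ConstsLt 16) :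
    e.Short b := by
  refine ⟨h, ?_⟩
  have : 2 ^ 4 ≤ 2 ^ b := Nat.pow_le_pow_right two_pos hb
  clear h
  induction e with
  | const k => exact lt_of_lt_of_le h' this
  | reg x => trivial
  | add e f ihe ihf | sub e f ihe ihf | mul e f ihe ihf | div e f ihe ihf =>
    exact ⟨ihe h'.1, ihf h'.2⟩

theorem takes_skip (hb : 4 ≤ b) (h : ∀ r, P r → Q (Function.update r 4 0)) :
    Takes n b skip P (unitTime b) Q :=
  Takes.assign (by omega) (Expr.Short.of_le hb (by simp [Expr.nodes]) (by simp [Expr.ConstsLt]))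
    fun r _ hr => ⟨by simp [Expr.eval], h r hr⟩

/-- The registers of `gallop`. -/
def GallopInv (n m K : ℕ) (r : ℕ → ℕ) : Prop :=
  r 0 = n ∧ r 11 ≤ m ∧ r 6 = 2 ^ r 5 ^ 2 ∧ r 7 = 2 ^ (2 * r 5 + 1) ∧ r 6 ≤ K

theorem sq_lt_of_gallopInv {r : ℕ → ℕ} (h : GallopInv n m K r) : r 5 ^ 2 < K :=
  (Nat.lt_two_pow_self.trans_eq h.2.2.1.symm).trans_le h.2.2.2.2

theorem two_pow_two_mul_le (t : ℕ) : 2 ^ (2 * t + 1) ≤ 2 * (2 ^ t ^ 2) ^ 2 := by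
  rw [← pow_mul, ← pow_succ']
  exact Nat.pow_le_pow_right two_pos (by nlinarith [Nat.le_self_pow two_ne_zero t])

def gallopStepTime (n b K : ℕ) : ℕ :=
  2 * unitTime b + (unitTime b + (testTime n b K + (2 * unitTime b + (2 * unitTime b +
    (unitTime b + (unitTime b + unitTime b)) + unitTime b) + unitTime b))) + unitTime b

def gallopTime (n b K : ℕ) : ℕ :=
  unitTime b + (unitTime b + (unitTime b + (unitTime b + (unitTime b + (n + 1) * gallopStepTime n b K))))

/-- The parameter grows only while it is at most `n`, and then the factor `2 ^ (2t + 1)` is at most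
`2n²`; so it never exceeds `2n³`. -/
theorem takes_gallopGrow (hb : 4 ≤ b) (hK : 2 * n ^ 3 + 2 ≤ K) (hKb : 8 * K ^ 2 < 2 ^ b) :
    Takes n b gallopGrow (fun r => GallopInv n m K r ∧ r 6 ≤ n)
      (unitTime b + (unitTime b + unitTime b)) (GallopInv n m K) := by
  have hb1 : 1 ≤ b := by omega
  have hK1 : K < 2 ^ b := by nlinarith
  refine Takes.seq (Q := fun r => r 0 = n ∧ r 11 ≤ m ∧ r 6 = 2 ^ (r 5 + 1) ^ 2 ∧
    r 7 = 2 ^ (2 * r 5 + 1) ∧ r 6 ≤ K) (Takes.assign hb1 (.of_le hb (by simp [Expr.nodes])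
      (by simp [Expr.ConstsLt])) fun r _ h => ?_) (Takes.seq (Q := fun r => r 0 = n ∧ r 11 ≤ m ∧
      r 6 = 2 ^ (r 5 + 1) ^ 2 ∧ r 7 = 2 ^ (2 * (r 5 + 1) + 1) ∧ r 6 ≤ K)
      (Takes.assign hb1 (.of_le hb (by simp [Expr.nodes]) (by simp [Expr.ConstsLt]))
      fun r _ h => ?_) (Takes.assign hb1 (.of_le hb (by simp [Expr.nodes])
      (by simp [Expr.ConstsLt])) fun r _ h => ?_))
  · obtain ⟨⟨h0, h11, h6, h7, hk⟩, hle⟩ := h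
    have h1 : r 6 * r 7 ≤ K := by
      have h2 : r 7 ≤ 2 * (r 6) ^ 2 := by
        rw [h6, h7]
        exact two_pow_two_mul_le _
      have h3 : r 6 * r 7 ≤ n * (2 * n ^ 2) :=
        Nat.mul_le_mul hle (h2.trans (Nat.mul_le_mul_left 2 (Nat.pow_le_pow_left hle 2)))
      have : n * (2 * n ^ 2) = 2 * n ^ 3 := by ring
      omega
    have h2 : r 6 * r 7 = 2 ^ (r 5 + 1) ^ 2 := by
      rw [h6, h7, ← pow_add]
      congr 1
      ring
    refine ⟨by simp only [Expr.eval]; omega, ?_⟩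
    rw [h2] at h1
    simp [Expr.eval, Function.update, h0, h11, h2]
    exact ⟨h7, h1⟩
  · obtain ⟨h0, h11, h6, h7, hk⟩ := h
    have h1 : r 7 * 4 = 2 ^ (2 * (r 5 + 1) + 1) := by
      rw [h7, show 4 = 2 ^ 2 by norm_num, ← pow_add]
      congr 1
    have h2 : r 7 * 4 < 2 ^ b := by
      have h3 := two_pow_two_mul_le (r 5 + 1)
      rw [← h6, ← h1] at h3
      have := Nat.pow_le_pow_left hk 2
      omega
    refine ⟨h2, ?_⟩
    simp [Expr.eval, Function.update, h0, h11, h6, h1]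
    omega
  · obtain ⟨h0, h11, h6, h7, hk⟩ := h
    have h1 : r 5 + 1 < K := (Nat.le_self_pow two_ne_zero _).trans_lt
      ((Nat.lt_two_pow_self.trans_eq h6.symm).trans_le hk)
    refine ⟨by simp only [Expr.eval]; omega, ?_⟩
    simp [Expr.eval, Function.update, GallopInv, h0, h11, h6, h7]
    omega

theorem takes_gallop (hb : 4 ≤ b) (hn : n < 2 ^ b) (hK : 2 * n ^ 3 + 2 ≤ K)
    (hKb : 8 * K ^ 2 < 2 ^ b) :
    Takes n b gallop (fun r => r 0 = n ∧ r 11 ≤ m) (gallopTime n b K) (GallopInv n m K) := by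
  have hb1 : 1 ≤ b := by omega
  have hK1 : K < 2 ^ b := by nlinarith
  have short : ∀ {e : Expr}, e.nodes ≤ 10 → e.ConstsLt 16 → e.Short b := .of_le hb
  have small : ∀ k, k < 16 → k < 2 ^ b := fun k hk => hk.trans_le
    (Nat.pow_le_pow_right two_pos hb : 2 ^ 4 ≤ 2 ^ b)
  refine Takes.seq (Q := fun r => r 0 = n ∧ r 11 ≤ m) (Takes.assign hb1
      (short (by simp [Expr.nodes]) (by simp [Expr.ConstsLt])) fun r _ h => ?_)
    (Takes.seq (Q := fun r => r 0 = n ∧ r 11 ≤ m ∧ r 5 = 0) (Takes.assign hb1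
      (short (by simp [Expr.nodes]) (by simp [Expr.ConstsLt])) fun r _ h => ?_)
    (Takes.seq (Q := fun r => r 0 = n ∧ r 11 ≤ m ∧ r 5 = 0 ∧ r 6 = 1) (Takes.assign hb1
      (short (by simp [Expr.nodes]) (by simp [Expr.ConstsLt])) fun r _ h => ?_)
    (Takes.seq (Q := GallopInv n m K) (Takes.assign hb1
      (short (by simp [Expr.nodes]) (by simp [Expr.ConstsLt])) fun r _ h => ?_)
    (Takes.loop hb1 (short (by simp [Expr.nodes]) (by simp [Expr.ConstsLt])) (n + 1)
      (fun _ => GallopInv n m K) (fun r h => ⟨by simp [Expr.eval, h.1], h⟩) (fun i _ =>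
      Takes.ite hb1 (short (by simp [Expr.nodes]) (by simp [Expr.ConstsLt]))
        (short (by simp [Expr.nodes]) (by simp [Expr.ConstsLt]))
        (Takes.seq (Q := fun r => GallopInv n m K r ∧ r 10 = r 6) (Takes.assign hb1
          (short (by simp [Expr.nodes]) (by simp [Expr.ConstsLt])) fun r _ h => ?_)
        (Takes.seq (takes_randomTest hb1 hK1 hn ?_ (fun r h => h.1.1) fun r h => ?_)
        (Takes.ite hb1 (short (by simp [Expr.nodes]) (by simp [Expr.ConstsLt]))
          (short (by simp [Expr.nodes]) (by simp [Expr.ConstsLt]))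
          (Takes.ite hb1 (short (by simp [Expr.nodes]) (by simp [Expr.ConstsLt]))
            (short (by simp [Expr.nodes]) (by simp [Expr.ConstsLt]))
            ((takes_gallopGrow hb hK hKb).mono (fun r h => ?_) le_rfl fun _ h => h)
            (Takes.assign hb1 (short (by simp [Expr.nodes]) (by simp [Expr.ConstsLt]))
              fun r _ h => ?_))
          (takes_skip hb fun r h => ?_))))
        (takes_skip hb fun r h => ?_))
      fun _ _ _ h => h))))
  · exact ⟨small 1 (by norm_num), by simpa [Expr.eval] using h⟩
  · exact ⟨small 0 (by norm_num), by simpa [Expr.eval] using h⟩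
  · exact ⟨small 1 (by norm_num), by simpa [Expr.eval] using h⟩
  · refine ⟨small 2 (by norm_num), ?_⟩
    simp [Expr.eval, GallopInv, h]
    omega
  · exact ⟨by have := h.1.2.2.2.2; simp only [Expr.eval]; omega,
      by simpa [Expr.eval, GallopInv, Function.update] using h.1⟩
  · intro r x v hx hx' h
    simp only [GallopInv] at *
    repeat rw [Function.update_of_ne (by omega)]
    exact h
  · rw [h.2]
    exact h.1.2.2.2.2
  · have h1 := h.2
    simp only [Expr.eval, h.1.1.1.1.1] at h1
    exact ⟨h.1.1.1.1, h1⟩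
  · exact ⟨small 0 (by norm_num), by simpa [GallopInv, Function.update] using h.1.1.1.1⟩
  · simpa [GallopInv, Function.update] using h.1.1.1
  · simpa [GallopInv, Function.update] using h.1

def bisectStepTime (n b K : ℕ) : ℕ :=
  unitTime b + (unitTime b + (testTime n b K + (2 * unitTime b + unitTime b + unitTime b)))

def bisectTime (n b K : ℕ) : ℕ :=
  unitTime b + (unitTime b + (unitTime b + K * bisectStepTime n b K))

/-- There are `t² < 2 ^ t ^ 2 ≤ K` rounds, and the sum of lower end and length never increases. -/
theorem takes_bisect (hb : 4 ≤ b) (hn : n < 2 ^ b) (hK1 : K < 2 ^ b) :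
    Takes n b bisect (GallopInv n m K) (bisectTime n b K)
      (fun r => r 0 = n ∧ r 11 ≤ m ∧ r 8 ≤ K) := by
  have hb1 : 1 ≤ b := by omega
  have short : ∀ {e : Expr}, e.nodes ≤ 10 → e.ConstsLt 16 → e.Short b := .of_le hb
  refine Takes.seq (Q := fun r => GallopInv n m K r ∧ r 8 = 0) (Takes.assign hb1
      (short (by simp [Expr.nodes]) (by simp [Expr.ConstsLt])) fun r _ h => ?_)
    (Takes.seq (Q := fun r => GallopInv n m K r ∧ r 8 + r 9 ≤ K) (Takes.assign hb1
      (short (by simp [Expr.nodes]) (by simp [Expr.ConstsLt])) fun r _ h => ?_)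
    (Takes.loop hb1 (short (by simp [Expr.nodes]) (by simp [Expr.ConstsLt])) K
      (fun _ r => r 0 = n ∧ r 11 ≤ m ∧ r 8 + r 9 ≤ K) (fun r h => ?_) (fun i _ =>
      Takes.seq (Q := fun r => r 0 = n ∧ r 11 ≤ m ∧ r 8 + 2 * r 9 ≤ K) (Takes.assign hb1
        (short (by simp [Expr.nodes]) (by simp [Expr.ConstsLt])) fun r _ h => ?_)
      (Takes.seq (Q := fun r => r 0 = n ∧ r 11 ≤ m ∧ r 8 + 2 * r 9 ≤ K ∧ r 10 = r 8 + r 9)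
        (Takes.assign hb1 (short (by simp [Expr.nodes]) (by simp [Expr.ConstsLt])) fun r _ h => ?_)
      (Takes.seq (takes_randomTest hb1 hK1 hn ?_ (fun r h => h.1) fun r h => ?_)
      (Takes.ite hb1 (short (by simp [Expr.nodes]) (by simp [Expr.ConstsLt]))
        (short (by simp [Expr.nodes]) (by simp [Expr.ConstsLt]))
        (Takes.assign hb1 (short (by simp [Expr.nodes]) (by simp [Expr.ConstsLt])) fun r hf h => ?_)
        (takes_skip hb fun r h => ?_)))))
      fun _ _ r h => ⟨h.1, h.2.1, by omega⟩))
  · exact ⟨by simp [Expr.eval], by simpa [GallopInv, Function.update, Expr.eval] using h⟩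
  · have h1 := h.1.2.2.2.2
    refine ⟨by simp only [Expr.eval]; omega, ?_⟩
    simpa [GallopInv, Function.update, Expr.eval, h.2] using ⟨h.1, h1⟩
  · have := sq_lt_of_gallopInv h.1
    rw [sq] at this
    exact ⟨this.le, h.1.1, h.1.2.1, h.2⟩
  · refine ⟨by simp only [Expr.eval]; omega, ?_⟩
    simp [Expr.eval, h.1, h.2.1]
    omega
  · refine ⟨by simp only [Expr.eval]; omega, ?_⟩
    simp [Expr.eval, h.1, h.2.1, h.2.2]
  · intro r x v hx hx' h
    repeat rw [Function.update_of_ne (by omega)]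
    exact h
  · omega
  · refine ⟨hf 10, ?_⟩
    obtain ⟨⟨⟨h0, h11, h8, h10⟩, -⟩, -⟩ := h
    simp [Expr.eval, h0, h11]
    omega
  · obtain ⟨⟨⟨h0, h11, h8, h10⟩, -⟩, -⟩ := h
    simp [h0, h11]
    omega

def walkStepTime (m n b M : ℕ) : ℕ :=
  2 * unitTime b + unitTime b + (measureTime m n b M + (2 * unitTime b + unitTime b +
    (2 * unitTime b + unitTime b + unitTime b)))

def walkTime (m n b K M : ℕ) : ℕ :=
  unitTime b + (unitTime b + (K + 1 + n + 5) * walkStepTime m n b M)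

/-- From at most `K + 1` the parameter rises by at most one in each of `K + n + 6` rounds, which
gives the bound `2K + n + 7`. -/
theorem takes_walk (hb : 4 ≤ b) (hn : n < 2 ^ b) (hm : 3 * m + 1 < 2 ^ b) (hM : M + 1 < 2 ^ b)
    (hKM : 2 * K + n + 7 ≤ M) :
    Takes n b (walk m) (fun r => r 0 = n ∧ r 11 ≤ m ∧ r 10 ≤ K + 1) (walkTime m n b K M)
      (fun r => r 0 = n ∧ r 11 ≤ m ∧ r 10 ≤ M) := by
  have hb1 : 1 ≤ b := by omega
  have short : ∀ {e : Expr}, e.nodes ≤ 10 → e.ConstsLt 16 → e.Short b := .of_le hb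
  refine Takes.seq (Q := fun r => r 0 = n ∧ r 11 ≤ m ∧ r 10 ≤ K + 1) (Takes.assign hb1
      (short (by simp [Expr.nodes]) (by simp [Expr.ConstsLt])) fun r _ h => ?_)
    (Takes.loop hb1 (short (by simp [Expr.nodes]) (by simp [Expr.ConstsLt])) (K + 1 + n + 5)
      (fun i r => r 0 = n ∧ r 11 ≤ m ∧ r 10 ≤ K + 1 + i) (fun r h => ?_) (fun i hi =>
      Takes.ite hb1 (short (by simp [Expr.nodes]) (by simp [Expr.ConstsLt]))
        (short (by simp [Expr.nodes]) (by simp [Expr.ConstsLt]))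
        (takes_skip hb fun r h => ?_)
        (Takes.seq (Q := fun r => r 0 = n ∧ r 11 ≤ m ∧ r 10 ≤ K + 1 + i)
          ((takes_measure hb1 (show M < 2 ^ b by omega) hn (show m < 2 ^ b by omega)
            (P := fun r => r 0 = n ∧ r 10 ≤ K + 1 + i) ?_ ?_ (fun r h => h.1)
            fun r h => ?_).mono (fun r h => ⟨h.1.1, h.1.2.2⟩) le_rfl fun r h => ?_)
        (Takes.ite hb1 (short (by simp [Expr.nodes]) (by simp [Expr.ConstsLt]))
          ⟨by simp [Expr.nodes], show m < 2 ^ b by omega⟩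
          (Takes.assign hb1 (short (by simp [Expr.nodes]) (by simp [Expr.ConstsLt]))
            fun r _ h => ?_)
          (Takes.ite hb1 ⟨by simp [Expr.nodes], hm⟩
            (short (by simp [Expr.nodes]) (by simp [Expr.ConstsLt]))
            (Takes.assign hb1 (short (by simp [Expr.nodes]) (by simp [Expr.ConstsLt]))
              fun r hf h => ?_)
            (Takes.assign hb1 (short (by simp [Expr.nodes]) (by simp [Expr.ConstsLt]))
              fun r _ h => ?_)))))
      fun i hi r h => ⟨h.1, h.2.1, by omega⟩)
  · exact ⟨by simp [Expr.eval], by simpa [Expr.eval] using h⟩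
  · simp only [Expr.eval]
    omega
  · simp [h.1]
    omega
  · intro r x v hx hx' h
    repeat rw [Function.update_of_ne (by omega)]
    exact h
  · intro r v h
    simpa using h
  · omega
  · omega
  · refine ⟨by simp only [Expr.eval]; omega, ?_⟩
    simp [Expr.eval, h.1]
    omega
  · refine ⟨by have := hf 10; simp only [Expr.eval]; omega, ?_⟩
    simp [Expr.eval, h.1]
    omega
  · refine ⟨by simp only [Expr.eval]; omega, ?_⟩
    simp [Expr.eval, h.1]
    omega

def computeStepTime (b : ℕ) : ℕ :=
  2 * unitTime b + unitTime b + (unitTime b + (unitTime b + unitTime b))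

def computeTime (n b M : ℕ) : ℕ :=
  unitTime b + ((unitTime b + M * unitTime b) + (unitTime b + (unitTime b + (unitTime b +
    (unitTime b + ((unitTime b + n * computeStepTime b) + unitTime b))))))

/-- The largest numbers of the algorithm occur here: powers of `2 ^ M` with exponent up to `2n + 1`,
whose length is still polynomial in `n`. -/
theorem takes_compute (hb : 4 ≤ b) (hn : n < 2 ^ b)
    (hMb : (2 ^ M) ^ (2 * n + 1) * (m * m) < 2 ^ b) (hmb : m * m < 2 ^ b) (hM2 : 2 ^ M * 2 < 2 ^ b) :
    Takes n b (compute m) (fun r => r 0 = n ∧ r 11 ≤ m ∧ r 10 ≤ M) (computeTime n b M)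
      (fun _ => True) := by
  have hb1 : 1 ≤ b := by omega
  have short : ∀ {e : Expr}, e.nodes ≤ 10 → e.ConstsLt 16 → e.Short b := .of_le hb
  have small : ∀ k, k < 16 → k < 2 ^ b := fun k hk => hk.trans_le
    (Nat.pow_le_pow_right two_pos hb : 2 ^ 4 ≤ 2 ^ b)
  have size : ∀ i, i ≤ n → ∀ x, x ≤ (2 ^ M) ^ (2 * i + 1) * (m * m) → x < 2 ^ b :=
    fun i hi x hx => (hx.trans (Nat.mul_le_mul_right _ (Nat.pow_le_pow_right (by positivity)
      (by omega)))).trans_lt hMb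
  have grow : ∀ i x y : ℕ, x ≤ (2 ^ M) ^ (2 * i + 1) * (m * m) → y ≤ 2 ^ M →
      x * (y * y) ≤ (2 ^ M) ^ (2 * (i + 1) + 1) * (m * m) := by
    intro i x y hx hy
    refine (Nat.mul_le_mul hx (Nat.mul_le_mul hy hy)).trans (le_of_eq ?_)
    ring
  refine Takes.seq (Q := fun r => r 0 = n ∧ r 11 ≤ m ∧ r 10 ≤ M ∧ r 13 = 1) (Takes.assign hb1
      (short (by simp [Expr.nodes]) (by simp [Expr.ConstsLt])) fun r _ h => ?_)
    (Takes.seq (Q := fun r => r 0 = n ∧ r 11 ≤ m ∧ r 13 ≤ 2 ^ M) (Takes.loop hb1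
      (short (by simp [Expr.nodes]) (by simp [Expr.ConstsLt])) M
      (fun i r => r 0 = n ∧ r 11 ≤ m ∧ r 13 ≤ 2 ^ i) (fun r h => ?_) (fun i hi => Takes.assign hb1
        (short (by simp [Expr.nodes]) (by simp [Expr.ConstsLt])) fun r _ h => ?_)
      fun i hi r h => ?_)
    (Takes.seq (Q := fun r => r 0 = n ∧ r 11 ≤ m ∧ r 13 ≤ 2 ^ M ∧ r 9 ≤ 2 ^ M) (Takes.assign hb1
      (short (by simp [Expr.nodes]) (by simp [Expr.ConstsLt])) fun r hf h => ?_)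
    (Takes.seq (Q := fun r => r 0 = n ∧ r 11 ≤ m ∧ r 13 ≤ 2 ^ M ∧ r 9 ≤ 2 ^ M ∧
        r 14 ≤ 2 ^ M * (m * m)) (Takes.assign hb1
      ⟨by simp [Expr.nodes], trivial, hmb⟩ fun r _ h => ?_)
    (Takes.seq (Q := fun r => r 0 = n ∧ r 13 ≤ 2 ^ M ∧ r 9 ≤ 2 ^ M ∧
        r 14 ≤ 2 ^ M * (m * m) ∧ r 15 ≤ 2 ^ M * (m * m)) (Takes.assign hb1
      (short (by simp [Expr.nodes]) (by simp [Expr.ConstsLt])) fun r _ h => ?_)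
    (Takes.seq (Q := fun r => r 0 = n ∧ r 13 ≤ 2 ^ M ∧ r 9 ≤ 2 ^ M ∧
        r 14 ≤ 2 ^ M * (m * m) ∧ r 15 ≤ 2 ^ M * (m * m) ∧ r 16 = 0) (Takes.assign hb1
      (short (by simp [Expr.nodes]) (by simp [Expr.ConstsLt])) fun r _ h => ?_)
    (Takes.seq (Q := fun _ => True) (Takes.loop hb1
      (short (by simp [Expr.nodes]) (by simp [Expr.ConstsLt])) n
      (fun i r => r 13 ≤ 2 ^ M ∧ r 9 ≤ 2 ^ M ∧ r 14 ≤ (2 ^ M) ^ (2 * i + 1) * (m * m) ∧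
        r 15 ≤ (2 ^ M) ^ (2 * i + 1) * (m * m) ∧ r 16 ≤ i) (fun r h => ?_) (fun i hi =>
      Takes.ite hb1 (short (by simp [Expr.nodes]) (by simp [Expr.ConstsLt]))
        (short (by simp [Expr.nodes]) (by simp [Expr.ConstsLt]))
        (takes_skip hb fun r h => ?_)
        (Takes.seq (Q := fun r => r 13 ≤ 2 ^ M ∧ r 9 ≤ 2 ^ M ∧
            r 14 ≤ (2 ^ M) ^ (2 * i + 1) * (m * m) ∧
            r 15 ≤ (2 ^ M) ^ (2 * i + 1) * (m * m) ∧ r 16 ≤ i + 1) (Takes.assign hb1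
          (short (by simp [Expr.nodes]) (by simp [Expr.ConstsLt])) fun r _ h => ?_)
        (Takes.seq (Q := fun r => r 13 ≤ 2 ^ M ∧ r 9 ≤ 2 ^ M ∧
            r 14 ≤ (2 ^ M) ^ (2 * (i + 1) + 1) * (m * m) ∧
            r 15 ≤ (2 ^ M) ^ (2 * i + 1) * (m * m) ∧ r 16 ≤ i + 1) (Takes.assign hb1
          (short (by simp [Expr.nodes]) (by simp [Expr.ConstsLt])) fun r _ h => ?_)
        (Takes.assign hb1
          (short (by simp [Expr.nodes]) (by simp [Expr.ConstsLt])) fun r _ h => ?_))))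
      fun _ _ _ _ => trivial)
    (Takes.assign hb1
      (short (by simp [Expr.nodes]) (by simp [Expr.ConstsLt])) fun r hf _ => ⟨hf 16, trivial⟩)))))))
  · exact ⟨small 1 (by norm_num), by simpa [Expr.eval] using h⟩
  · exact ⟨h.2.2.1, h.1, h.2.1, by simp [h.2.2.2]⟩
  · have h1 : r 13 * 2 ≤ 2 ^ (i + 1) := by
      rw [pow_succ]
      exact Nat.mul_le_mul_right 2 h.2.2
    have h2 : 2 ^ (i + 1) ≤ 2 ^ M := Nat.pow_le_pow_right two_pos hi
    refine ⟨by simp only [Expr.eval]; omega, ?_⟩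
    simpa [Expr.eval, h.1, h.2.1] using h1
  · exact ⟨h.1, h.2.1, h.2.2.trans (Nat.pow_le_pow_right two_pos hi)⟩
  · refine ⟨by simp only [Expr.eval]; omega, ?_⟩
    simp [Expr.eval, h.1, h.2.1, h.2.2]
    omega
  · have h1 : r 9 * (m * m) ≤ 2 ^ M * (m * m) := Nat.mul_le_mul_right _ h.2.2.2
    exact ⟨size 0 (Nat.zero_le _) _ (by simpa [Expr.eval] using h1), by
      simpa [Expr.eval, h.1, h.2.1, h.2.2] using h1⟩
  · have h1 : r 13 * (r 11 * r 11) ≤ 2 ^ M * (m * m) :=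
      Nat.mul_le_mul h.2.2.1 (Nat.mul_le_mul h.2.1 h.2.1)
    exact ⟨size 0 (Nat.zero_le _) _ (by simpa [Expr.eval] using h1), by
      simpa [Expr.eval, h.1, h.2.2] using h1⟩
  · exact ⟨small 0 (by norm_num), by simpa [Expr.eval] using h⟩
  · exact ⟨h.1.le, h.2.1, h.2.2.1, by simpa using h.2.2.2.1, by simpa using h.2.2.2.2.1,
      h.2.2.2.2.2.le⟩
  · obtain ⟨⟨h13, h9, h14, h15, h16⟩, -⟩ := h
    have : (2 ^ M) ^ (2 * i + 1) * (m * m) ≤ (2 ^ M) ^ (2 * (i + 1) + 1) * (m * m) :=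
      Nat.mul_le_mul_right _ (Nat.pow_le_pow_right (by positivity) (by omega))
    simpa [h13, h9] using ⟨h14.trans this, h15.trans this, by omega⟩
  · obtain ⟨⟨h13, h9, h14, h15, h16⟩, -⟩ := h
    refine ⟨by simp only [Expr.eval]; omega, ?_⟩
    simpa [Expr.eval, h13, h9, h14, h15] using h16
  · obtain ⟨h13, h9, h14, h15, h16⟩ := h
    have h1 := grow i _ _ h14 h9
    exact ⟨size (i + 1) hi _ h1, by simpa [Expr.eval, h13, h9, h15, h16] using h1⟩
  · obtain ⟨h13, h9, h14, h15, h16⟩ := h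
    have h1 := grow i _ _ h15 h13
    exact ⟨size (i + 1) hi _ h1, by simpa [Expr.eval, h13, h9, h14, h16] using h1⟩

end GroupTesting

/-! ### Polynomial running time of the whole algorithm -/

namespace GroupTesting

variable {n b m K M : ℕ}

def coreTime (m n b K M : ℕ) : ℕ :=
  unitTime b + (testTime n b K + (2 * unitTime b + (gallopTime n b K + (bisectTime n b K +
    unitTime b) + (walkTime m n b K M + computeTime n b M)) + unitTime b))

theorem takes_core (hb : 4 ≤ b) (hn : n < 2 ^ b) (hK : 2 * n ^ 3 + 2 ≤ K)
    (hKb : 8 * K ^ 2 < 2 ^ b) (hm : 3 * m + 1 < 2 ^ b) (hM : M + 1 < 2 ^ b)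
    (hKM : 2 * K + n + 7 ≤ M) (hMb : (2 ^ M) ^ (2 * n + 1) * (m * m) < 2 ^ b)
    (hmb : m * m < 2 ^ b) (hM2 : 2 ^ M * 2 < 2 ^ b) :
    Takes n b (core m) (fun r => r 0 = n ∧ r 11 ≤ m) (coreTime m n b K M) (fun _ => True) := by
  have hb1 : 1 ≤ b := by omega
  have hK1 : K < 2 ^ b := by omega
  have short : ∀ {e : Expr}, e.nodes ≤ 10 → e.ConstsLt 16 → e.Short b := .of_le hb
  refine Takes.seq (Q := fun r => r 0 = n ∧ r 11 ≤ m ∧ r 10 = 0) (Takes.assign hb1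
      (short (by simp [Expr.nodes]) (by simp [Expr.ConstsLt])) fun r _ h => ?_)
    (Takes.seq (takes_randomTest hb1 hK1 hn ?_ (fun r h => h.1) fun r h => by omega)
    (Takes.ite hb1 (short (by simp [Expr.nodes]) (by simp [Expr.ConstsLt]))
      (short (by simp [Expr.nodes]) (by simp [Expr.ConstsLt]))
      (Takes.seq (Takes.seq ((takes_gallop (m := m) hb hn hK hKb).mono
        (fun r h => ⟨h.1.1.1, h.1.1.2.1⟩) le_rfl fun _ h => h)
        (Takes.seq (takes_bisect hb hn hK1) (Takes.assign hb1
          (short (by simp [Expr.nodes]) (by simp [Expr.ConstsLt])) fun r _ h => ?_)))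
        (Takes.seq (takes_walk hb hn hm hM hKM) (takes_compute hb hn hMb hmb hM2)))
      (Takes.assign hb1 (short (by simp [Expr.nodes]) (by simp [Expr.ConstsLt]))
        fun r _ _ => ⟨by simp [Expr.eval], trivial⟩)))
  · exact ⟨by simp [Expr.eval], by simpa [Expr.eval] using h⟩
  · intro r x v hx hx' h
    repeat rw [Function.update_of_ne (by omega)]
    exact h
  · refine ⟨by simp only [Expr.eval]; omega, ?_⟩
    simpa [Expr.eval] using h

/-- With `u` the unit time and `X = T + 4u`, the subtracted `3u` closes the recurrence exactly: `3u
+ 2 (2ˡ X - 3u) = 2ˡ⁺¹ X - 3u`. The factor `2ˡ` does not depend on `n`. -/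
theorem takes_biased {p : Prog} {P : (ℕ → ℕ) → Prop} {T : ℕ} (hb : 4 ≤ b)
    (hP : ∀ r v, P r → P (Function.update r 4 v)) (hp : Takes n b p P T (fun _ => True)) (l a : ℕ) :
    Takes n b (biased p l a) P (2 ^ l * (T + 4 * unitTime b) - 3 * unitTime b) (fun _ => True) := by
  have hb1 : 1 ≤ b := by omega
  have short : ∀ {e : Expr}, e.nodes ≤ 10 → e.ConstsLt 16 → e.Short b := .of_le hb
  induction l generalizing a with
  | zero =>
    rw [biased]
    split_ifs
    · exact hp.mono (fun _ h => h) (by omega) fun _ h => h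
    · exact (Takes.assign hb1 (short (by simp [Expr.nodes]) (by simp [Expr.ConstsLt]))
        (P := P) (Q := fun _ => True) fun r _ _ => ⟨by simp [Expr.eval], trivial⟩).mono
        (fun _ h => h) (by omega) fun _ h => h
  | succ l ih =>
    have hT : 1 * (T + 4 * unitTime b) ≤ 2 ^ l * (T + 4 * unitTime b) :=
      Nat.mul_le_mul_right _ Nat.one_le_two_pow
    refine (Takes.seq (Takes.coin hb1 fun r h v _ => hP r v h)
      (Takes.ite hb1 (short (by simp [Expr.nodes]) (by simp [Expr.ConstsLt]))
        (short (by simp [Expr.nodes]) (by simp [Expr.ConstsLt]))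
        ((ih (a - 2 ^ l)).mono (fun _ h => h.1) le_rfl fun _ h => h)
        ((ih (min a (2 ^ l))).mono (fun _ h => h.1) le_rfl fun _ h => h))).mono
        (fun _ h => h) ?_ fun _ h => h
    rw [pow_succ, mul_right_comm]
    omega

/-- `f` is bounded by a polynomial. -/
def PolyBounded (f : ℕ → ℕ) : Prop := ∃ P : Polynomial ℕ, ∀ n, f n ≤ P.eval n

namespace PolyBounded

variable {f g b K M : ℕ → ℕ}

theorem const (c : ℕ) : PolyBounded fun _ => c := ⟨Polynomial.C c, fun n => by simp⟩

theorem id : PolyBounded fun n => n := ⟨Polynomial.X, fun n => by simp⟩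

theorem add (hf : PolyBounded f) (hg : PolyBounded g) : PolyBounded fun n => f n + g n := by
  obtain ⟨P, hP⟩ := hf
  obtain ⟨Q, hQ⟩ := hg
  exact ⟨P + Q, fun n => by simpa using Nat.add_le_add (hP n) (hQ n)⟩

theorem mul (hf : PolyBounded f) (hg : PolyBounded g) : PolyBounded fun n => f n * g n := by
  obtain ⟨P, hP⟩ := hf
  obtain ⟨Q, hQ⟩ := hg
  exact ⟨P * Q, fun n => by simpa using Nat.mul_le_mul (hP n) (hQ n)⟩

theorem unitTime (hb : PolyBounded b) : PolyBounded fun n => unitTime (b n) :=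
  (const 100).mul (hb.add (const 1))

theorem testTime (hb : PolyBounded b) (hM : PolyBounded M) :
    PolyBounded fun n => testTime n (b n) (M n) := by
  have hu := hb.unitTime
  exact hu.add (hu.add ((hu.add (id.mul ((hu.add (hu.add (hM.mul (hu.add hu)))).add
    ((((const 2).mul hu).add hu |>.add hu).add hu)))).add hu))

theorem gallopTime (hb : PolyBounded b) (hK : PolyBounded K) :
    PolyBounded fun n => gallopTime n (b n) (K n) := by
  have hu := hb.unitTime
  have ht := hb.testTime hK
  have h2 := (const 2).mul hu
  exact hu.add (hu.add (hu.add (hu.add (hu.add ((id.add (const 1)).mul ((h2.add (hu.add (ht.add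
    ((h2.add ((h2.add (hu.add (hu.add hu))).add hu)).add hu)))).add hu))))))

theorem bisectTime (hb : PolyBounded b) (hK : PolyBounded K) :
    PolyBounded fun n => bisectTime n (b n) (K n) := by
  have hu := hb.unitTime
  have ht := hb.testTime hK
  have h2 := (const 2).mul hu
  exact hu.add (hu.add (hu.add (hK.mul (hu.add (hu.add (ht.add ((h2.add hu).add hu)))))))

theorem walkTime (m : ℕ) (hb : PolyBounded b) (hK : PolyBounded K) (hM : PolyBounded M) :
    PolyBounded fun n => walkTime m n (b n) (K n) (M n) := by
  have hu := hb.unitTime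
  have ht := hb.testTime hM
  have h2 := (const 2).mul hu
  have hmeas : PolyBounded fun n => measureTime m n (b n) (M n) :=
    hu.add (hu.add ((const m).mul (ht.add hu)))
  exact hu.add (hu.add ((((hK.add (const 1)).add id).add (const 5)).mul ((h2.add hu).add
    (hmeas.add ((h2.add hu).add ((h2.add hu).add hu))))))

theorem computeTime (hb : PolyBounded b) (hM : PolyBounded M) :
    PolyBounded fun n => computeTime n (b n) (M n) := by
  have hu := hb.unitTime
  have h2 := (const 2).mul hu
  exact hu.add ((hu.add (hM.mul hu)).add (hu.add (hu.add (hu.add (hu.add ((hu.add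
    (id.mul ((h2.add hu).add (hu.add (hu.add hu))))).add hu))))))

theorem coreTime (m : ℕ) (hb : PolyBounded b) (hK : PolyBounded K) (hM : PolyBounded M) :
    PolyBounded fun n => coreTime m n (b n) (K n) (M n) := by
  have hu := hb.unitTime
  exact hu.add ((hb.testTime hK).add ((((const 2).mul hu).add (((hb.gallopTime hK).add
    ((hb.bisectTime hK).add hu)).add ((hb.walkTime m hK hM).add (hb.computeTime hM)))).add hu))

end PolyBounded

theorem polynomialTime_biased_core (m l a : ℕ) : (biased (core m) l a).PolynomialTime := by
  set K : ℕ → ℕ := fun n => 2 * (n * (n * n)) + 2 with hK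
  set M : ℕ → ℕ := fun n => 2 * K n + n + 7 with hM
  -- Enough bits for `(2 ^ M) ^ (2n + 1) * m²`, the largest number that occurs; `2m` covers `m²`,
  -- and `10` the small constants.
  set b : ℕ → ℕ := fun n => M n * (2 * n + 1) + 2 * m + 10 with hb
  have pK : PolyBounded K := ((PolyBounded.const 2).mul (PolyBounded.id.mul
    (PolyBounded.id.mul PolyBounded.id))).add (PolyBounded.const 2)
  have pM : PolyBounded M := (((PolyBounded.const 2).mul pK).add PolyBounded.id).add
    (PolyBounded.const 7)
  have pb : PolyBounded b := ((pM.mul (((PolyBounded.const 2).mul PolyBounded.id).add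
    (PolyBounded.const 1))).add (PolyBounded.const (2 * m))).add (PolyBounded.const 10)
  obtain ⟨P, hP⟩ := (PolyBounded.const (2 ^ l)).mul
    ((PolyBounded.coreTime m pb pK pM).add ((PolyBounded.const 4).mul pb.unitTime))
  refine ⟨P, fun n I s hs => ?_⟩
  have pw : ∀ i, i ≤ b n → 2 ^ i ≤ 2 ^ b n := fun i hi => Nat.pow_le_pow_right two_pos hi
  have hMb : M n ≤ M n * (2 * n + 1) := Nat.le_mul_of_pos_right _ (by omega)
  have hbn : b n = M n * (2 * n + 1) + 2 * m + 10 := rfl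
  have hMn : M n = 2 * K n + n + 7 := rfl
  have e1 : M n < 2 ^ M n := Nat.lt_two_pow_self
  have e2 : 2 ^ M n * 2 ≤ 2 ^ (M n + 1) := (pow_succ _ _).ge
  have e3 : 2 ^ (M n + 1) < 2 ^ b n := Nat.pow_lt_pow_right one_lt_two (by omega)
  have e4 : m < 2 ^ m := Nat.lt_two_pow_self
  have e5 : m * m < 2 ^ (2 * m) := by
    rw [two_mul, pow_add]
    exact Nat.mul_lt_mul'' e4 e4
  have e6 : 2 ^ (2 * m) ≤ 2 ^ b n := pw _ (by omega)
  have e7 : 2 ^ m * 4 ≤ 2 ^ b n := by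
    rw [show 4 = 2 ^ 2 by norm_num, ← pow_add]
    exact pw _ (by omega)
  have e8 : 8 * K n ^ 2 < 2 ^ b n := by
    have h1 : K n < 2 ^ K n := Nat.lt_two_pow_self
    have h2 := Nat.pow_lt_pow_left h1 two_ne_zero
    have h3 : 8 * (2 ^ K n) ^ 2 ≤ 2 ^ b n := by
      rw [← pow_mul, show 8 = 2 ^ 3 by norm_num, ← pow_add]
      exact pw _ (by omega)
    omega
  have e9 : (2 ^ M n) ^ (2 * n + 1) * (m * m) < 2 ^ b n := by
    have h1 : (2 ^ M n) ^ (2 * n + 1) * 2 ^ (2 * m) ≤ 2 ^ b n := by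
      rw [← pow_mul, ← pow_add]
      exact pw _ (by omega)
    exact (Nat.mul_lt_mul_of_pos_left e5 (by positivity)).trans_le h1
  have hcore := takes_core (n := n) (b := b n) (m := m) (K := K n) (M := M n) (by omega) (by omega)
    (by simp only [hK]; ring_nf; rfl) e8 (by omega) (by omega) le_rfl e9 (by omega) (by omega)
  have key := takes_biased (by omega) (fun r v h => by simpa using h) hcore l a I (initial n) ?_ ?_
    s hs
  · simpa [initial] using key.2.2.trans (by simpa [initial] using (Nat.sub_le _ _).trans (hP n))
  · intro x
    simp only [initial, Function.update_apply]
    split_ifs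
    · omega
    · positivity
  · simp [initial]

end GroupTesting

/-! ### Choice of the running probability and conclusion -/

namespace GroupTesting

theorem output_toMeasure_ge {A : Prog} {n : ℕ} {I : Finset (Fin n)} {S : Set ℕ} {δ : ℝ}
    (hδ : 0 ≤ δ) (h : ExpLE (A.exec I) (fun _ => True)
      (fun t => open Classical in if t.reg 0 ∈ S then 0 else 1) δ) :
    ENNReal.ofReal (1 - δ) ≤ (A.output I).toMeasure S := by
  classical
  rw [PMF.toMeasure_apply_eq_toOuterMeasure, Prog.output, PMF.toOuterMeasure_map_apply,
    PMF.toOuterMeasure_apply, ENNReal.ofReal_sub _ hδ, ENNReal.ofReal_one, tsub_le_iff_right]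
  refine le_trans ?_ (add_le_add_right h.2 _)
  rw [← ENNReal.tsum_add, ← PMF.tsum_coe (A.exec I)]
  refine ENNReal.tsum_le_tsum fun t => ?_
  by_cases ht : t.reg 0 ∈ S <;> simp [Set.indicator, ht]

theorem exists_dyadic_between {x η : ℝ} (hx : 0 ≤ x) (hη : 0 < η) (hx1 : x + η / 2 ≤ 1) :
    ∃ l a : ℕ, a ≤ 2 ^ l ∧ x + η / 2 ≤ (a / 2 ^ l : ℝ) ∧ (a / 2 ^ l : ℝ) ≤ x + η := by
  obtain ⟨l, hl⟩ := exists_pow_lt_of_lt_one (show 0 < η / 2 by positivity)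
    (show (1 / 2 : ℝ) < 1 by norm_num)
  have h2 : (0 : ℝ) < 2 ^ l := by positivity
  rw [one_div, inv_pow, inv_lt_iff_one_lt_mul₀ h2] at hl
  have h0 : 0 ≤ (x + η / 2) * 2 ^ l := by positivity
  refine ⟨l, ⌈(x + η / 2) * 2 ^ l⌉₊, ?_, ?_, ?_⟩
  · rw [Nat.ceil_le]
    push_cast
    nlinarith
  · rw [le_div_iff₀ h2]
    exact Nat.le_ceil _
  · rw [div_le_iff₀ h2]
    have := (Nat.ceil_lt_add_one h0).le
    linarith

end GroupTesting

open GroupTesting in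
theorem theorem8 (c : ℝ) (hc : 1 < c) :
    ∃ C : ℝ, ∀ ε δ : ℝ, 0 < ε → ε < 1 → 0 < δ → δ < 1 →
      ∃ A : GroupTesting.Prog, A.PolynomialTime ∧
        ∀ (n : ℕ) (I : Finset (Fin n)),
          ENNReal.ofReal (1 - δ) ≤ (A.output I).toMeasure
            {D : ℕ | (1 - ε) * (I.card : ℝ) ≤ (D : ℝ) ∧ (D : ℝ) ≤ (1 + ε) * (I.card : ℝ)} ∧
          A.expectedQueries I ≤ ENNReal.ofReal
            ((1 - δ + δ ^ c) * GroupTesting.loglog I.card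
              + C * Real.sqrt (GroupTesting.loglog I.card)
              + C * (1 / ε ^ 2 * Real.logb 2 (1 / δ))) := by
  refine ⟨3 * 10 ^ 8 * (4 + c), fun ε δ hε hε1 hδ hδ1 => ?_⟩
  set e := δ ^ c with he
  have he0 : 0 < e := Real.rpow_pos_of_pos hδ c
  have heδ : e ≤ δ := by
    simpa using Real.rpow_le_rpow_of_exponent_ge hδ hδ1.le hc.le
  -- The running probability will lie between `1 - δ + η / 2` and `1 - δ + η`. The cap `1 - δ` makes
  -- such a choice possible within `[0, 1]`, and it keeps `π ≤ 2 (1 - δ)`.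
  set η := min e (1 - δ) with hη
  have hη0 : 0 < η := lt_min he0 (by linarith)
  have hηe : η ≤ e := min_le_left _ _
  have hηδ : η ≤ 1 - δ := min_le_right _ _
  obtain ⟨l, a, hal, hlow, hhigh⟩ := exists_dyadic_between (show 0 ≤ 1 - δ by linarith) hη0
    (by linarith)
  set π : ℝ := a / 2 ^ l with hπ
  have hπ0 : 0 < π := by linarith
  have hπ1 : π ≤ 1 := by
    rw [hπ, div_le_one (by positivity)]
    exact_mod_cast hal
  obtain ⟨m, hm⟩ := exists_core_spec hε hε1 (show 0 < e / 3 by positivity) (by linarith)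
  refine ⟨biased (core m) l a, polynomialTime_biased_core m l a, fun n I => ?_⟩
  have hl := loglog_nonneg I.card
  have hs := Real.sqrt_nonneg (loglog I.card)
  have h0 : (initial n).reg 0 = n := by simp [initial]
  have hlog2 : 0 < Real.log 2 := Real.log_pos one_lt_two
  have hlog2' : Real.log 2 ≤ 1 := by linarith [Real.log_two_lt_d9]
  have hL : 1 - δ ≤ Real.logb 2 (1 / δ) := by
    rw [Real.logb, le_div_iff₀ hlog2, one_div, Real.log_inv]
    nlinarith [Real.log_le_sub_one_of_pos hδ]
  have hL3 : Real.logb 2 (1 / (e / 3)) ≤ 2 + c * Real.logb 2 (1 / δ) := by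
    rw [show 1 / (e / 3) = 3 * (1 / δ) ^ c by
      rw [one_div δ, Real.inv_rpow hδ.le, ← he]
      field_simp, Real.logb_mul (by norm_num) (by positivity),
      Real.logb_rpow_eq_mul_logb_of_pos (by positivity)]
    have : Real.logb 2 3 ≤ 2 := by
      rw [Real.logb_le_iff_le_rpow (by norm_num) (by norm_num)]
      norm_num
    linarith
  set L := Real.logb 2 (1 / δ)
  set L' := Real.logb 2 (1 / (e / 3))
  have hL' : 0 ≤ L' := Real.logb_nonneg (by norm_num) (by
    rw [le_div_iff₀ (by positivity)]
    linarith)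
  have hL0 : 0 ≤ L := by linarith
  constructor
  · refine output_toMeasure_ge hδ.le ((expLE_biased (V := e / 3) (W := 1) (by positivity) zero_le_one
      (fun s hs ha => (hm n I s hs ha).1) (fun t _ _ => ?_) l a hal (initial n) h0 rfl).mono
      (fun _ h => h) (fun t _ => ?_) ?_)
    · split_ifs <;> norm_num
    · simp only [Set.mem_ofPred_eq]
      split_ifs <;> norm_num
    · rw [← hπ]
      -- The failure probability is at most `π e / 3 + 1 - π`. If `η = e`, this is at most `e / 3 +
      -- δ - e / 2`. If `η = 1 - δ`, then `π (1 - e / 3) ≥ (3 / 2)(1 - δ)(2 / 3) = 1 - δ`.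
      rcases min_choice e (1 - δ) with h | h
      · rw [← hη] at h
        rw [h] at hlow
        nlinarith
      · rw [← hη] at h
        rw [h] at hlow
        nlinarith
  · refine ((expLE_biased (F := fun t => (t.asked : ℝ)) (W := 0) (by positivity) le_rfl
      (fun s hs ha => (hm n I s hs ha).2) (fun t _ ha => by simp [ha]) l a hal (initial n) h0
      rfl).mono (F' := fun t => (t.asked : ℝ)) (fun _ h => h) (fun _ _ => le_rfl) ?_).2.trans'
      (le_of_eq ?_)
    rotate_left
    · simp [Prog.expectedQueries, Prog.exec]
    · rw [← hπ]
      have h1 : π * loglog I.card ≤ (1 - δ + e) * loglog I.card :=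
        mul_le_mul_of_nonneg_right (by linarith) hl
      have h2 : π * √(loglog I.card) ≤ √(loglog I.card) := mul_le_of_le_one_left hs hπ1
      -- The additive `2` must vanish together with `L` as `δ` tends to `1`: it is multiplied by `π
      -- ≤ 2 (1 - δ) ≤ 2L`, which gives the `4`.
      have h3 : π * L' ≤ (4 + c) * L := by
        have h4 : π * L' ≤ π * (2 + c * L) := mul_le_mul_of_nonneg_left hL3 hπ0.le
        have h5 : π * (c * L) ≤ c * L := mul_le_of_le_one_left (by positivity) hπ1
        linarith
      have h4 : 1 / ε ^ 2 * (π * L') ≤ 1 / ε ^ 2 * ((4 + c) * L) :=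
        mul_le_mul_of_nonneg_left h3 (by positivity)
      have h5 : 0 ≤ c * √(loglog I.card) := by positivity
      linarith
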